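/- Let $\Bbbk$ be a field, $n \in \mathbb N$, and let $\mathcal M = ([n]\cup\{g\}, \mathcal L, g)$, $g \notin [n]=\{1,\dots,n\}$, be an oriented matroid given by its set of covectors $\mathcal L \subseteq \{0,+,-\}^{[n]\cup\{g\}}$, with a distinguished element $g$ that is not a coloop (i.e. no covector has support $\{g\}$; $g$ is allowed to be a loop). Order sign vectors componentwise by $0<+$, $0<-$, with $+$ and $-$ incomparable. Let $\mathcal L^+=\{\lambda\in\mathcal L : \lambda(g)=+\}$, and let $\mathcal B_{\mathcal M}$ be the set of all $\lambda\in\mathcal L^+$ such that every $\mu\in\mathcal L$ with $0<\mu\le\lambda$ lies in $\mathcal L^+$. Put $\widetilde S=\Bbbk[x_1,\dots,x_n,y_1,\dots,y_n]$, $S=\Bbbk[x_1,\dots,x_n]$, $$\mathsf m_\lambda=\prod_{i\in[n],\,\lambda(i)=+}x_i\cdot\prod_{i\in[n],\,\lambda(i)=-}y_i,\qquad O_{\mathcal M}=(\mathsf m_\lambda \mid \lambda\in\mathcal B_{\mathcal M})\subseteq\widetilde S$$ (so $O_{\mathcal M}=0$ if $g$ is a loop), and let $\overline{O_{\mathcal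 M}}\subseteq S$ be the image of $O_{\mathcal M}$ under the $\Bbbk$-algebra homomorphism $\widetilde S\to S$, $x_i\mapsto x_i$, $y_i\mapsto x_i$. Then $x_1-y_1,\dots,x_n-y_n$ is a regular sequence on $\widetilde S/O_{\mathcal M}$. Moreover, $\widetilde S/O_{\mathcal M}$ is Cohen–Macaulay if and only if $S/\overline{O_{\mathcal M}}$ is Cohen–Macaulay. -/

import Mathlib

/-- The set of indices at which two sign vectors are opposite and non-zero. -/
def signSeparation {E : Type*} (u v : E → SignType) : Set E :=
  {e | u e = -v e ∧ u e ≠ 0}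

/-- The composition of sign vectors: `u` where `u` is non-zero, and `v` elsewhere. -/
def signComp {E : Type*} (u v : E → SignType) : E → SignType :=
  fun e => if u e = 0 then v e else u e

/-- The conformal order on sign vectors, induced componentwise by `0 < +` and `0 < -` with
`+` and `-` incomparable. (This is not the linear order `- < 0 < +` of `SignType`.) -/
def signConforms {E : Type*} (u v : E → SignType) : Prop :=
  ∀ e, u e = 0 ∨ u e = v e

/-- An oriented matroid on a finite set `E`, given by its covectors. -/
structure OrientedMatroid (E : Type*) [Finite E] where
  /-- The set of covectors. -/
  covectors : Set (E → SignType)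
  zero_mem : 0 ∈ covectors
  neg_mem : ∀ u ∈ covectors, -u ∈ covectors
  comp_mem : ∀ u ∈ covectors, ∀ v ∈ covectors, signComp u v ∈ covectors
  elimination : ∀ u ∈ covectors, ∀ v ∈ covectors, ∀ e ∈ signSeparation u v,
    ∃ w ∈ covectors, w e = 0 ∧
      ∀ f, f ∉ signSeparation u v → w f = signComp u v f ∧ w f = signComp v u f

namespace OrientedMatroid

/-- An element `e` is a coloop if some covector has support exactly `{e}`. -/
def IsColoop {E : Type*} [Finite E] (M : OrientedMatroid E) (e : E) : Prop :=
  ∃ u ∈ M.covectors, Function.support u = {e}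

/-- The positive part with respect to the distinguished element `g`. -/
def positivePart {E : Type*} [Finite E] (M : OrientedMatroid E) (g : E) :
    Set (E → SignType) :=
  {u | u ∈ M.covectors ∧ u g = 1}

/-- The bounded complex with respect to `g`: those `u` in the positive part such that every
non-zero covector below `u` also lies in the positive part. -/
def boundedComplex {E : Type*} [Finite E] (M : OrientedMatroid E) (g : E) :
    Set (E → SignType) :=
  {u | u ∈ M.positivePart g ∧
    ∀ v ∈ M.covectors, v ≠ 0 → signConforms v u → v ∈ M.positivePart g}

end OrientedMatroid

section MatroidIdeal

/-! The ground set `{1, …, n} ∪ {g}` is `Option (Fin n)`, with `g = none`. In the polynomial ring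
in the variables `x₁, …, xₙ, y₁, …, yₙ`, indexed by `Fin n ⊕ Fin n`, the variable `xᵢ` is
`X (Sum.inl i)` and `yᵢ` is `X (Sum.inr i)`. -/

open MvPolynomial

/-- The monomial of a sign vector: the product of the `xᵢ` with `u i = +` and the `yᵢ` with
`u i = -`, over `i ≠ g`. -/
noncomputable def signMonomial (k : Type*) [Field k] {n : ℕ} (u : Option (Fin n) → SignType) :
    MvPolynomial (Fin n ⊕ Fin n) k :=
  (∏ i with u (some i) = 1, X (Sum.inl i)) * ∏ i with u (some i) = -1, X (Sum.inr i)

/-- The matroid ideal of the affine oriented matroid `(M, g)`. -/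
noncomputable def matroidIdeal (k : Type*) [Field k] {n : ℕ}
    (M : OrientedMatroid (Option (Fin n))) : Ideal (MvPolynomial (Fin n ⊕ Fin n) k) :=
  Ideal.span (signMonomial k '' M.boundedComplex none)

/-- The `k`-algebra homomorphism `k[x, y] → k[x]` sending `xᵢ` and `yᵢ` to `xᵢ`. -/
noncomputable def specialization (k : Type*) [Field k] (n : ℕ) :
    MvPolynomial (Fin n ⊕ Fin n) k →ₐ[k] MvPolynomial (Fin n) k :=
  aeval (Sum.elim X X)

/-- The image of the matroid ideal under `yᵢ ↦ xᵢ`. -/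
noncomputable def reducedMatroidIdeal (k : Type*) [Field k] {n : ℕ}
    (M : OrientedMatroid (Option (Fin n))) : Ideal (MvPolynomial (Fin n) k) :=
  (matroidIdeal k M).map (specialization k n)

end MatroidIdeal

section CohenMacaulay

/-- The depth of a local ring: the supremum of the lengths of the regular sequences in the maximal
ideal. -/
noncomputable def localRingDepth (R : Type*) [CommRing R] [IsLocalRing R] : ℕ∞ :=
  ⨆ rs ∈ {rs : List R | (∀ r ∈ rs, r ∈ IsLocalRing.maximalIdeal R) ∧
    RingTheory.Sequence.IsRegular R rs}, (rs.length : ℕ∞)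

/-- A Cohen-Macaulay ring: a Noetherian ring whose localization at each maximal ideal has depth
equal to its Krull dimension. -/
structure IsCohenMacaulayRing (R : Type*) [CommRing R] : Prop where
  isNoetherianRing : IsNoetherianRing R
  depth_eq_dim : ∀ (m : Ideal R) [m.IsMaximal],
    (localRingDepth (Localization.AtPrime m) : WithBot ℕ∞) = ringKrullDim (Localization.AtPrime m)

end CohenMacaulay

/-!
Write `B = k[x, y] / O` and `θᵢ = xᵢ - yᵢ`.

*Regularity.* Modulo `θ₁, …, θⱼ₋₁` the ideal `O` is still a squarefree monomial ideal: the variables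
`xᵢ` and `yᵢ` with `i < j` are merged (`mem_matroidIdeal_sup_iff`). For a squarefree monomial ideal
whose generators satisfy an elimination property with respect to two variables `x` and `y`, the form
`x - y` is a nonzerodivisor (`mem_squarefreeIdeal_of_X_sub_X_mul_mem`). For the pair `xⱼ, yⱼ` this
property is elimination in the bounded complex (`OrientedMatroid.boundedComplex_elimination`):
covector elimination produces a covector that is positive at `g`, and below it lies a bounded one,
because a covector of minimal support among the conforming ones that are positive at `g` is bounded.
As `g` is not a coloop, no generator of `O` is constant, so that the quotient by the whole sequence
is not zero.

*Cohen–Macaulayness.* The ring `k[x] / Ō` is the quotient of `B` by the regular sequence `θ`. Hence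
depth equals dimension at a prime of `k[x] / Ō` if and only if it does at the preimage of this prime
in `B` (`localRingDepth_localization_eq_iff`). This rests on the theorem of Rees, by which division
by a regular element of the maximal ideal lowers the depth by exactly one. One direction follows
at once. For the other, the maximal ideals of `B` that do not contain `θ` have to be reached; all of
them are controlled by the origin. Let `D` be the largest size of a face, that is, of a set of
variables whose product is not in `O`. Then `dim B ≤ D`, because `B` is integral over the first `D`
elementary symmetric polynomials `e₁, …, e_D` (`isIntegral_esymm`), and the local ring at the origin
has dimension `D` (`card_le_height_of_face`). If this local ring is Cohen–Macaulay, then its system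
of parameters `e₁ ^ a₁, …, e_D ^ a_D` is a regular sequence, and by homogeneity it is one on `B`
(`esymm_pow_isWeaklyRegular`). Given a maximal ideal `𝔫` of `B`, the Nullstellensatz yields monic
polynomials `pᵢ` in one variable with `pᵢ(eᵢ) ∈ 𝔫`. The leading forms of the `pᵢ(eᵢ)` are powers of
the `eᵢ`, so that these elements too form a regular sequence (`IsLeadingIdeal.isWeaklyRegular`), and
the depth at `𝔫` is at least `D` (`isCohenMacaulayRing_of_localization_origin`).
-/

/-! ### Elimination in the bounded complex -/

namespace OrientedMatroid

variable {E : Type*} [Finite E] (M : OrientedMatroid E)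

/-- Conformal elimination: a covector `z` supported inside `v` that differs from `v` can be
replaced by a covector conforming to `v`, still different from `v`, without changing the common
value at `g`. Eliminating repeatedly between `v` and `z` removes the separation set. -/
lemma exists_conforming_ne {v z : E → SignType} {g : E} (hv : v ∈ M.covectors)
    (hz : z ∈ M.covectors) (hsupp : ∀ f, v f = 0 → z f = 0) (hg : z g = v g) (hne : z ≠ v) :
    ∃ w ∈ M.covectors, signConforms w v ∧ w g = v g ∧ w ≠ v := by
  induction hN : (signSeparation v z).ncard using Nat.strong_induction_on generalizing z with
  | _ N ih =>
  subst hN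
  by_cases hemp : signSeparation v z = ∅
  · refine ⟨z, hz, fun f => ?_, hg, hne⟩
    have hf : f ∉ signSeparation v z := by simp [hemp]
    have h0 := hsupp f
    simp only [signSeparation, Set.mem_ofPred_eq] at hf
    revert hf h0
    generalize v f = a
    generalize z f = b
    revert a b
    decide
  · obtain ⟨e, he⟩ := Set.nonempty_iff_ne_empty.mpr hemp
    obtain ⟨w, hw, hwe, hwf⟩ := M.elimination v hv z hz e he
    have key : ∀ f, v f ≠ 0 → f ∉ signSeparation v z → w f = v f := fun f hf hs => by
      simpa [signComp, hf] using (hwf f hs).1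
    have hzero : ∀ f, v f = 0 → w f = 0 := fun f hf => by
      have hs : f ∉ signSeparation v z := fun h => h.2 hf
      simpa [signComp, hf, hsupp f hf] using (hwf f hs).1
    refine ih _ ?_ hw hzero ?_ ?_ rfl
    · refine Set.ncard_lt_ncard ⟨fun f hf => ?_, fun h => ?_⟩ (Set.toFinite _)
      · by_contra hs
        have h1 := key f hf.2 hs
        have h2 := hf.1
        have h3 := hf.2
        rw [h1] at h2
        revert h2 h3
        generalize v f = a
        revert a
        decide
      · have := (h he).1
        rw [hwe] at this
        exact he.2 (by simpa using this)
    · by_cases h0 : v g = 0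
      · rw [hzero g h0, h0]
      · refine key g h0 fun hs => ?_
        have h1 := hs.1
        rw [hg] at h1
        revert h0 h1
        generalize v g = a
        revert a
        decide
    · intro h
      exact he.2 (by rw [← h, hwe])

/-- Below every covector that is positive at `g` lies one in the bounded complex: a conforming
covector of minimal support that is positive at `g`. -/
lemma exists_mem_boundedComplex_conforms {g : E} {u : E → SignType}
    (hu : u ∈ M.positivePart g) : ∃ v ∈ M.boundedComplex g, signConforms v u := by
  classical
  obtain ⟨v, ⟨hv, hvu⟩, hmin⟩ := exists_minimalFor_of_wellFoundedLT
    (fun v => v ∈ M.positivePart g ∧ signConforms v u)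
    (fun v : E → SignType => (Function.support v).ncard) ⟨u, hu, fun _ => Or.inr rfl⟩
  refine ⟨v, ⟨hv, fun w hw hw0 hwv => ⟨hw, ?_⟩⟩, hvu⟩
  by_contra hwg
  have hwg0 : w g = 0 := (hwv g).resolve_right fun h => hwg (h.trans hv.2)
  obtain ⟨e, he⟩ := Function.ne_iff.mp hw0
  have hwe : w e = v e := (hwv e).resolve_left he
  -- The covector `(-w) ∘ v` agrees with `v` off the support of `w`, in particular at `g`.
  obtain ⟨z, hz, hzv, hzg, hzne⟩ := M.exists_conforming_ne (g := g) hv.1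
    (M.comp_mem _ (M.neg_mem _ hw) _ hv.1) (fun f hf => by
      have : w f = 0 := by rcases hwv f with h | h <;> simp [h, hf]
      simp [signComp, this, hf]) (by simp [signComp, hwg0]) (fun h => by
      have h1 := congrFun h e
      simp only [signComp, Pi.neg_apply, hwe] at h1
      have h2 : v e ≠ 0 := hwe ▸ he
      revert h1 h2
      generalize v e = a
      revert a
      decide)
  have hsub : Function.support z ⊂ Function.support v := by
    refine ⟨fun f hf => ?_, fun h => hzne (funext fun f => ?_)⟩
    · rw [Function.mem_support, ← (hzv f).resolve_left hf]
      exact hf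
    · by_cases hf : v f = 0
      · rcases hzv f with h' | h' <;> simp [h', hf]
      · exact (hzv f).resolve_left (h hf)
  have hcard := Set.ncard_lt_ncard hsub (Set.toFinite _)
  have hzu : signConforms z u := fun f => by
    rcases hzv f with h | h
    · exact Or.inl h
    · rw [h]
      exact hvu f
  exact absurd (hmin ⟨⟨hz, hzg.trans hv.2⟩, hzu⟩ hcard.le) (not_le.mpr hcard)

/-- Elimination inside the bounded complex. -/
lemma boundedComplex_elimination {g i : E} {u v : E → SignType} (hu : u ∈ M.boundedComplex g)
    (hv : v ∈ M.boundedComplex g) (hui : u i = 1) (hvi : v i = -1) :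
    ∃ w ∈ M.boundedComplex g, w i = 0 ∧ ∀ f, w f = 0 ∨ w f = u f ∨ w f = v f := by
  obtain ⟨w, hw, hwi, hwf⟩ := M.elimination u hu.1.1 v hv.1.1 i ⟨by simp [hui, hvi], by simp [hui]⟩
  have hg : g ∉ signSeparation u v := by simp [signSeparation, hu.1.2, hv.1.2]
  obtain ⟨z, hz, hzw⟩ := M.exists_mem_boundedComplex_conforms (g := g) (u := w)
    ⟨hw, by simpa [signComp, hu.1.2] using (hwf g hg).1⟩
  refine ⟨z, hz, by rcases hzw i with h | h <;> simp [h, hwi], fun f => ?_⟩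
  rcases hzw f with h | h
  · exact Or.inl h
  rw [h]
  by_cases hf : f ∈ signSeparation u v
  · have h1 := hf.1
    have h2 := hf.2
    revert h1 h2
    generalize u f = a
    generalize v f = b
    generalize w f = c
    revert a b c
    decide
  · have := (hwf f hf).1
    unfold signComp at this
    split_ifs at this
    · exact Or.inr (Or.inr this)
    · exact Or.inr (Or.inl this)

end OrientedMatroid

/-! ### Squarefree monomial ideals -/

section SquarefreeMonomialIdeals

open MvPolynomial

variable {σ : Type*} (k : Type*) [Field k]

/-- The squarefree monomial ideal generated by the monomials `∏ v ∈ T, X v` with `T ∈ F`. -/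
noncomputable def squarefreeIdeal (F : Set (Finset σ)) : Ideal (MvPolynomial σ k) :=
  Ideal.span ((fun T : Finset σ => ∏ v ∈ T, X v) '' F)

variable {k}

lemma prod_X_eq_monomial (T : Finset σ) :
    (∏ v ∈ T, X v : MvPolynomial σ k) = monomial (∑ v ∈ T, Finsupp.single v 1) 1 := by
  simp [X, monomial_sum_index]

lemma sum_single_le_iff (T : Finset σ) (u : σ →₀ ℕ) :
    ∑ v ∈ T, Finsupp.single v 1 ≤ u ↔ T ⊆ u.support := by
  classical
  have h : ∀ w, (∑ v ∈ T, Finsupp.single v 1) w = if w ∈ T then 1 else 0 := fun w => by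
    simp [Finsupp.finsetSum_apply, Finsupp.single_apply]
  constructor
  · intro hle w hw
    have := hle w
    rw [h, if_pos hw] at this
    exact Finsupp.mem_support_iff.mpr (by omega)
  · intro hs w
    rw [h]
    split_ifs with hw
    · have := Finsupp.mem_support_iff.mp (hs hw)
      omega
    · exact Nat.zero_le _

lemma mem_squarefreeIdeal_iff {F : Set (Finset σ)} {f : MvPolynomial σ k} :
    f ∈ squarefreeIdeal k F ↔ ∀ u ∈ f.support, ∃ T ∈ F, T ⊆ u.support := by
  have : squarefreeIdeal k F = Ideal.span ((fun s => monomial s (1 : k)) ''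
      ((fun T : Finset σ => ∑ v ∈ T, Finsupp.single v 1) '' F)) := by
    simp only [squarefreeIdeal, Set.image_image, prod_X_eq_monomial]
  rw [this, mem_ideal_span_monomial_image]
  simp [sum_single_le_iff]

/-- If the supports of the generators satisfy an elimination property with respect to the variables
`x` and `y`, then `X x - X y` is a nonzerodivisor modulo the ideal. For a monomial `u` of `f`
outside the ideal, comparison of coefficients in `(X x - X y) * f` shows that both `X x * u` and
`X y * u` lie in the ideal, and elimination produces a generator dividing `u`. -/
lemma mem_squarefreeIdeal_of_X_sub_X_mul_mem {F : Set (Finset σ)} {x y : σ} (hxy : x ≠ y)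
    (hF : ∀ A ∈ F, ∀ B ∈ F, x ∈ A → y ∈ B →
      ∃ C ∈ F, (∀ v ∈ C, v ∈ A ∨ v ∈ B) ∧ x ∉ C ∧ y ∉ C)
    {f : MvPolynomial σ k} (hf : (X x - X y) * f ∈ squarefreeIdeal k F) :
    f ∈ squarefreeIdeal k F := by
  classical
  rw [mem_squarefreeIdeal_iff] at hf ⊢
  set P : (σ →₀ ℕ) → Prop := fun u => ∃ T ∈ F, T ⊆ u.support with hP
  have mono : ∀ u w, P u → P (u + w) := fun u w ⟨T, hT, h⟩ => ⟨T, hT, h.trans fun v hv => by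
    rw [Finsupp.mem_support_iff] at hv ⊢
    simp only [Finsupp.add_apply]
    omega⟩
  by_contra hcon
  -- The exponents of `f` outside the ideal.
  set U := f.support.filter fun u => ¬ P u with hU
  have hUne : U.Nonempty := by
    push Not at hcon
    obtain ⟨u, hu, h⟩ := hcon
    exact ⟨u, Finset.mem_filter.mpr ⟨hu, fun ⟨T, hT, h'⟩ => h T hT h'⟩⟩
  have new : ∀ u : σ →₀ ℕ, ∀ z, ¬ P u → P (u + Finsupp.single z 1) →
      u z = 0 ∧ ∃ T ∈ F, z ∈ T ∧ ∀ v ∈ T, v = z ∨ v ∈ u.support := by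
    rintro u z hu ⟨T, hT, h⟩
    have h' : ∀ v ∈ T, v = z ∨ v ∈ u.support := fun v hv => by
      by_cases hvz : v = z
      · exact Or.inl hvz
      · have := h hv
        rw [Finsupp.mem_support_iff, Finsupp.add_apply,
          Finsupp.single_eq_of_ne hvz, add_zero] at this
        exact Or.inr (Finsupp.mem_support_iff.mpr this)
    have hz : z ∉ u.support := fun hz => hu ⟨T, hT, fun v hv => (h' v hv).elim (· ▸ hz) id⟩
    refine ⟨Finsupp.notMem_support_iff.mp hz, T, hT, ?_, h'⟩
    by_contra hzT
    exact hu ⟨T, hT, fun v hv => (h' v hv).resolve_left fun h => hzT (h ▸ hv)⟩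
  have hcoeff : ∀ u z w, coeff (u + Finsupp.single z 1) (X w * f) =
      if w ∈ (u + Finsupp.single z 1).support then
        coeff (u + Finsupp.single z 1 - Finsupp.single w 1) f else 0 :=
    fun u z w => by rw [coeff_X_mul']
  -- An exponent of `U` with the largest `x`-degree gives `X x * u` in the ideal.
  have hx0 : ∀ u ∈ U, u x = 0 := by
    obtain ⟨u, hu, hmax⟩ := U.exists_max_image (fun u => u x) hUne
    suffices P (u + Finsupp.single x 1) by
      have h0 := (new u x (Finset.mem_filter.mp hu).2 this).1
      intro w hw
      have := hmax w hw
      omega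
    by_cases hy : y ∈ (u + Finsupp.single x 1).support ∧
        coeff (u + Finsupp.single x 1 - Finsupp.single y 1) f ≠ 0
    · set w := u + Finsupp.single x 1 - Finsupp.single y 1 with hw
      have hwu : w + Finsupp.single y 1 = u + Finsupp.single x 1 := by
        refine tsub_add_cancel_of_le ?_
        rw [Finsupp.single_le_iff]
        have := Finsupp.mem_support_iff.mp hy.1
        omega
      rw [← hwu]
      refine mono _ _ ?_
      by_contra hPw
      have h1 := hmax w (Finset.mem_filter.mpr ⟨mem_support_iff.mpr hy.2, hPw⟩)
      have h2 := DFunLike.congr_fun hwu x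
      simp [hxy] at h2
      omega
    · refine hf _ (mem_support_iff.mpr ?_)
      have h0 : coeff (u + Finsupp.single x 1) (X y * f) = 0 := by
        rw [hcoeff]
        split_ifs with h
        · by_contra h'
          exact hy ⟨h, h'⟩
        · rfl
      rw [sub_mul, coeff_sub, h0, sub_zero, add_comm, coeff_X_mul]
      exact mem_support_iff.mp (Finset.mem_filter.mp hu).1
  obtain ⟨u, hu⟩ := hUne
  have hu' := Finset.mem_filter.mp hu
  have hux := hx0 u hu
  have hPy : P (u + Finsupp.single y 1) := by
    refine hf _ (mem_support_iff.mpr ?_)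
    have h0 : coeff (u + Finsupp.single y 1) (X x * f) = 0 := by
      rw [hcoeff, if_neg]
      simp [hux, hxy]
    rw [sub_mul, coeff_sub, h0, zero_sub, add_comm, coeff_X_mul, neg_ne_zero]
    exact mem_support_iff.mp hu'.1
  obtain ⟨huy, B, hB, hyB, hB'⟩ := new u y hu'.2 hPy
  have hPx : P (u + Finsupp.single x 1) := by
    refine hf _ (mem_support_iff.mpr ?_)
    have h0 : coeff (u + Finsupp.single x 1) (X y * f) = 0 := by
      rw [hcoeff, if_neg]
      simp [huy, hxy.symm]
    rw [sub_mul, coeff_sub, h0, sub_zero, add_comm, coeff_X_mul]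
    exact mem_support_iff.mp hu'.1
  obtain ⟨-, A, hA, hxA, hA'⟩ := new u x hu'.2 hPx
  obtain ⟨C, hC, hCAB, hxC, hyC⟩ := hF A hA B hB hxA hyB
  refine hu'.2 ⟨C, hC, fun v hv => ?_⟩
  rcases hCAB v hv with h | h
  · exact (hA' v h).resolve_left fun h => hxC (h ▸ hv)
  · exact (hB' v h).resolve_left fun h => hyC (h ▸ hv)

end SquarefreeMonomialIdeals

/-! ### Regularity of the sequence `xᵢ - yᵢ` -/

section RegularSequence

open MvPolynomial

variable (k : Type*) [Field k] {n : ℕ}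

/-- The index set of the variables that divide the monomial of a sign vector. -/
def signVars (u : Option (Fin n) → SignType) : Finset (Fin n ⊕ Fin n) :=
  (Finset.univ.filter fun i => u (some i) = 1).disjSum
    (Finset.univ.filter fun i => u (some i) = -1)

@[simp]
lemma inl_mem_signVars {u : Option (Fin n) → SignType} {i : Fin n} :
    Sum.inl i ∈ signVars u ↔ u (some i) = 1 := by
  simp [signVars]

@[simp]
lemma inr_mem_signVars {u : Option (Fin n) → SignType} {i : Fin n} :
    Sum.inr i ∈ signVars u ↔ u (some i) = -1 := by
  simp [signVars]

lemma signMonomial_eq_prod (u : Option (Fin n) → SignType) :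
    signMonomial k u = ∏ v ∈ signVars u, X v := by
  rw [signMonomial, signVars, Finset.prod_disjSum]

/-- The identification of the index of `yᵢ` with that of `xᵢ` for all `i < j`. -/
def mergeVars (j : ℕ) : Fin n ⊕ Fin n → Fin n ⊕ Fin n
  | Sum.inl i => Sum.inl i
  | Sum.inr i => if (i : ℕ) < j then Sum.inl i else Sum.inr i

lemma mergeVars_injOn_signVars (j : ℕ) (u : Option (Fin n) → SignType) :
    Set.InjOn (mergeVars j) (signVars u : Set (Fin n ⊕ Fin n)) := by
  rintro (a | a) ha (b | b) hb hab <;>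
    simp only [Finset.mem_coe, inl_mem_signVars, inr_mem_signVars] at ha hb <;>
    simp only [mergeVars] at hab
  · exact hab
  · split_ifs at hab
    rw [Sum.inl.inj hab, hb] at ha
    exact absurd ha (by decide)
  · split_ifs at hab
    rw [Sum.inl.inj hab, hb] at ha
    exact absurd ha (by decide)
  · split_ifs at hab
    · rw [Sum.inl.inj hab]
    · exact hab

lemma rename_mergeVars_signMonomial (j : ℕ) (u : Option (Fin n) → SignType) :
    rename (mergeVars j) (signMonomial k u) = ∏ v ∈ (signVars u).image (mergeVars j), X v := by
  rw [signMonomial_eq_prod, map_prod, Finset.prod_image (mergeVars_injOn_signVars j u)]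
  simp only [rename_X]

lemma inl_mem_image_mergeVars {j : Fin n} {u : Option (Fin n) → SignType} :
    Sum.inl j ∈ (signVars u).image (mergeVars j) ↔ u (some j) = 1 := by
  simp only [Finset.mem_image]
  constructor
  · rintro ⟨a | a, ha, h⟩ <;> simp only [mergeVars] at h
    · rw [Sum.inl.inj h] at ha
      simpa using ha
    · split_ifs at h with h'
      rw [Sum.inl.inj h] at h'
      omega
  · exact fun h => ⟨Sum.inl j, by simpa using h, rfl⟩

lemma inr_mem_image_mergeVars {j : Fin n} {u : Option (Fin n) → SignType} :
    Sum.inr j ∈ (signVars u).image (mergeVars j) ↔ u (some j) = -1 := by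
  simp only [Finset.mem_image]
  constructor
  · rintro ⟨a | a, ha, h⟩ <;> simp only [mergeVars] at h
    · exact absurd h (by simp)
    · split_ifs at h with h'
      rw [Sum.inr.inj h] at ha
      simpa using ha
  · exact fun h => ⟨Sum.inr j, by simpa using h, by simp [mergeVars]⟩

/-- The linear forms `xᵢ - yᵢ`. -/
noncomputable def diffVars (n : ℕ) : List (MvPolynomial (Fin n ⊕ Fin n) k) :=
  List.ofFn fun i : Fin n => X (Sum.inl i) - X (Sum.inr i)

lemma mem_take_diffVars {j : ℕ} {r : MvPolynomial (Fin n ⊕ Fin n) k} :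
    r ∈ (diffVars k n).take j ↔ ∃ i : Fin n, (i : ℕ) < j ∧ r = X (Sum.inl i) - X (Sum.inr i) := by
  simp only [diffVars, List.mem_take_iff_getElem, List.length_ofFn, List.getElem_ofFn, lt_min_iff]
  constructor
  · rintro ⟨i, hi, rfl⟩
    exact ⟨⟨i, hi.2⟩, hi.1, rfl⟩
  · rintro ⟨i, hi, rfl⟩
    exact ⟨i, ⟨hi, i.2⟩, rfl⟩

variable {k} in
/-- An algebra endomorphism that is the identity on the variables modulo an ideal is the identity
modulo that ideal. -/
lemma MvPolynomial.sub_mem_of_forall_X_sub_mem {σ : Type*} {K : Ideal (MvPolynomial σ k)}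
    (φ : MvPolynomial σ k →ₐ[k] MvPolynomial σ k) (h : ∀ i, X i - φ (X i) ∈ K)
    (f : MvPolynomial σ k) : f - φ f ∈ K := by
  have : Ideal.Quotient.mkₐ k K = (Ideal.Quotient.mkₐ k K).comp φ :=
    algHom_ext fun i => Ideal.Quotient.eq.mpr (h i)
  exact Ideal.Quotient.eq.mp (DFunLike.congr_fun this f)

lemma sub_rename_mergeVars_mem (j : ℕ) (f : MvPolynomial (Fin n ⊕ Fin n) k) :
    f - rename (mergeVars j) f ∈ Ideal.ofList ((diffVars k n).take j) := by
  refine sub_mem_of_forall_X_sub_mem _ (fun v => ?_) f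
  rw [rename_X]
  rcases v with i | i
  · simp [mergeVars]
  · simp only [mergeVars]
    split_ifs with h
    · rw [← neg_sub]
      exact neg_mem (Ideal.subset_span ((mem_take_diffVars k).mpr ⟨i, h, rfl⟩))
    · simp

/-- Modulo the first `j` forms `xᵢ - yᵢ`, the matroid ideal becomes the squarefree monomial ideal
obtained by merging the first `j` pairs of variables. -/
lemma mem_matroidIdeal_sup_iff (M : OrientedMatroid (Option (Fin n))) (j : ℕ)
    (f : MvPolynomial (Fin n ⊕ Fin n) k) :
    f ∈ matroidIdeal k M ⊔ Ideal.ofList ((diffVars k n).take j) ↔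
      rename (mergeVars j) f ∈ squarefreeIdeal k
        ((fun u => (signVars u).image (mergeVars j)) '' M.boundedComplex none) := by
  set I := squarefreeIdeal k
    ((fun u => (signVars u).image (mergeVars j)) '' M.boundedComplex none) with hI
  have hgen : ∀ u ∈ M.boundedComplex none, rename (mergeVars j) (signMonomial k u) ∈ I :=
    fun u hu => by
      rw [rename_mergeVars_signMonomial]
      exact Ideal.subset_span ⟨_, ⟨u, hu, rfl⟩, rfl⟩
  constructor
  · intro hf
    suffices h : matroidIdeal k M ⊔ Ideal.ofList ((diffVars k n).take j) ≤
        I.comap (rename (mergeVars j)) from h hf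
    refine sup_le (Ideal.span_le.mpr ?_) (Ideal.span_le.mpr ?_)
    · rintro _ ⟨u, hu, rfl⟩
      exact hgen u hu
    · intro r hr
      obtain ⟨i, hi, rfl⟩ := (mem_take_diffVars k).mp hr
      simp [mergeVars, hi]
  · intro hf
    rw [← sub_add_cancel f (rename (mergeVars j) f)]
    refine add_mem (Ideal.mem_sup_right (sub_rename_mergeVars_mem k j f)) ?_
    suffices h : I ≤ matroidIdeal k M ⊔ Ideal.ofList ((diffVars k n).take j) from h hf
    refine Ideal.span_le.mpr ?_
    rintro _ ⟨_, ⟨u, hu, rfl⟩, rfl⟩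
    simp only
    rw [← rename_mergeVars_signMonomial, ← sub_sub_cancel (signMonomial k u)
      (rename (mergeVars j) (signMonomial k u))]
    exact sub_mem (Ideal.mem_sup_left (Ideal.subset_span ⟨u, hu, rfl⟩))
      (Ideal.mem_sup_right (sub_rename_mergeVars_mem k j _))

lemma mem_matroidIdeal_sup_of_mul_mem (M : OrientedMatroid (Option (Fin n))) (j : Fin n)
    {f : MvPolynomial (Fin n ⊕ Fin n) k} (hf : (X (Sum.inl j) - X (Sum.inr j)) * f ∈
      matroidIdeal k M ⊔ Ideal.ofList ((diffVars k n).take j)) :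
    f ∈ matroidIdeal k M ⊔ Ideal.ofList ((diffVars k n).take j) := by
  rw [mem_matroidIdeal_sup_iff] at hf ⊢
  have hl : mergeVars (n := n) j (Sum.inl j) = Sum.inl j := rfl
  have hr : mergeVars (n := n) j (Sum.inr j) = Sum.inr j := by simp [mergeVars]
  rw [map_mul, map_sub, rename_X, rename_X, hl, hr] at hf
  refine mem_squarefreeIdeal_of_X_sub_X_mul_mem (by simp) ?_ hf
  rintro _ ⟨u, hu, rfl⟩ _ ⟨v, hv, rfl⟩ hju hjv
  rw [inl_mem_image_mergeVars] at hju
  rw [inr_mem_image_mergeVars] at hjv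
  obtain ⟨w, hw, hwj, hwuv⟩ := M.boundedComplex_elimination hu hv hju hjv
  refine ⟨_, ⟨w, hw, rfl⟩, fun a ha => ?_, ?_, ?_⟩
  · obtain ⟨b, hb, rfl⟩ := Finset.mem_image.mp ha
    suffices b ∈ signVars u ∨ b ∈ signVars v from
      this.imp (Finset.mem_image_of_mem _) (Finset.mem_image_of_mem _)
    rcases b with i | i <;> simp only [inl_mem_signVars, inr_mem_signVars] at hb ⊢ <;>
      rcases hwuv (some i) with h | h | h <;> rw [hb] at h
    · exact absurd h (by decide)
    · exact Or.inl h.symm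
    · exact Or.inr h.symm
    · exact absurd h (by decide)
    · exact Or.inl h.symm
    · exact Or.inr h.symm
  · rw [inl_mem_image_mergeVars, hwj]
    decide
  · rw [inr_mem_image_mergeVars, hwj]
    decide

/-- In a cyclic module `R ⧸ I`, membership in the submodule generated by an ideal `K`. -/
lemma Ideal.Quotient.mk_mem_smul_top_iff {R : Type*} [CommRing R] (I K : Ideal R) (f : R) :
    (Ideal.Quotient.mk I f) ∈ (K • ⊤ : Submodule R (R ⧸ I)) ↔ f ∈ I ⊔ K := by
  have h : (K • ⊤ : Submodule R (R ⧸ I)) = Submodule.map (Submodule.mkQ I) K := by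
    rw [← Submodule.range_mkQ I, LinearMap.range_eq_map, ← Submodule.map_smul'']
    simp
  rw [h, ← Submodule.comap_map_mkQ]
  rfl

/-- Regular sequences on a cyclic module `R ⧸ I` in terms of ideals of `R`. -/
lemma RingTheory.Sequence.isWeaklyRegular_quotient_iff {R : Type*} [CommRing R] (I : Ideal R)
    (rs : List R) : IsWeaklyRegular (R ⧸ I) rs ↔ ∀ (i : ℕ) (hi : i < rs.length) (f : R),
      rs[i] * f ∈ I ⊔ Ideal.ofList (rs.take i) → f ∈ I ⊔ Ideal.ofList (rs.take i) := by
  rw [isWeaklyRegular_iff]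
  refine forall₂_congr fun i hi => ?_
  rw [isSMulRegular_quotient_iff_mem_of_smul_mem]
  rw [Ideal.Quotient.mk_surjective.forall]
  refine forall_congr' fun f => ?_
  rw [← Ideal.Quotient.mk_mem_smul_top_iff, ← Ideal.Quotient.mk_mem_smul_top_iff]
  rfl

lemma diffVars_isWeaklyRegular (M : OrientedMatroid (Option (Fin n))) :
    RingTheory.Sequence.IsWeaklyRegular
      (MvPolynomial (Fin n ⊕ Fin n) k ⧸ matroidIdeal k M) (diffVars k n) := by
  rw [RingTheory.Sequence.isWeaklyRegular_quotient_iff]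
  intro i hi f hf
  have hi' : i < n := by simpa [diffVars] using hi
  refine mem_matroidIdeal_sup_of_mul_mem k M ⟨i, hi'⟩ ?_
  simpa [diffVars] using hf

/-- If `g` is not a coloop, then no monomial of a bounded cell is constant. -/
lemma matroidIdeal_le_ker_constantCoeff (M : OrientedMatroid (Option (Fin n)))
    (hg : ¬ M.IsColoop none) :
    matroidIdeal k M ≤ RingHom.ker (constantCoeff (σ := Fin n ⊕ Fin n) (R := k)) := by
  refine Ideal.span_le.mpr ?_
  rintro _ ⟨u, hu, rfl⟩
  have hne : (signVars u).Nonempty := by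
    by_contra h
    rw [Finset.not_nonempty_iff_eq_empty] at h
    refine hg ⟨u, hu.1.1, Set.ext fun a => ?_⟩
    rcases a with _ | i
    · simp [hu.1.2]
    · have h1 : Sum.inl i ∉ signVars u := by simp [h]
      have h2 : Sum.inr i ∉ signVars u := by simp [h]
      simp only [inl_mem_signVars, inr_mem_signVars] at h1 h2
      rcases SignType.trichotomy (u (some i)) with h' | h' | h' <;> simp_all
  obtain ⟨v, hv⟩ := hne
  simp only [SetLike.mem_coe, RingHom.mem_ker, signMonomial_eq_prod, map_prod]
  exact Finset.prod_eq_zero hv (by simp)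

lemma diffVars_isRegular (M : OrientedMatroid (Option (Fin n))) (hg : ¬ M.IsColoop none) :
    RingTheory.Sequence.IsRegular
      (MvPolynomial (Fin n ⊕ Fin n) k ⧸ matroidIdeal k M) (diffVars k n) := by
  refine ⟨diffVars_isWeaklyRegular k M, fun htop => ?_⟩
  have h1 : Ideal.Quotient.mk (matroidIdeal k M) 1 ∈ (Ideal.ofList (diffVars k n) • ⊤ :
      Submodule (MvPolynomial (Fin n ⊕ Fin n) k)
        (MvPolynomial (Fin n ⊕ Fin n) k ⧸ matroidIdeal k M)) := by
    rw [← htop]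
    trivial
  rw [Ideal.Quotient.mk_mem_smul_top_iff] at h1
  have hle : matroidIdeal k M ⊔ Ideal.ofList (diffVars k n) ≤
      RingHom.ker (constantCoeff (σ := Fin n ⊕ Fin n) (R := k)) := by
    refine sup_le (matroidIdeal_le_ker_constantCoeff k M hg) (Ideal.span_le.mpr ?_)
    intro r hr
    obtain ⟨i, rfl⟩ := List.mem_ofFn.mp hr
    simp
  simpa using hle h1

/-- The kernel of the projection of `k[x, y]` onto the reduced quotient. -/
lemma ker_mk_comp_specialization (M : OrientedMatroid (Option (Fin n))) :
    RingHom.ker ((Ideal.Quotient.mk (reducedMatroidIdeal k M)).comp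
      (specialization k n : MvPolynomial (Fin n ⊕ Fin n) k →+* MvPolynomial (Fin n) k)) =
      matroidIdeal k M ⊔ Ideal.ofList (diffVars k n) := by
  have hsurj : Function.Surjective (specialization k n) := fun f =>
    ⟨rename Sum.inl f, by
      rw [specialization, aeval_rename, Sum.elim_comp_inl, aeval_X_left_apply]⟩
  apply le_antisymm
  · intro f hf
    have hf' : specialization k n f ∈ (matroidIdeal k M).map (specialization k n) :=
      Ideal.Quotient.eq_zero_iff_mem.mp hf
    obtain ⟨g, hg, hgf⟩ := (Ideal.mem_map_iff_of_surjective _ hsurj).mp hf'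
    rw [← add_sub_cancel g f]
    refine add_mem (Ideal.mem_sup_left hg) (Ideal.mem_sup_right ?_)
    have := sub_mem_of_forall_X_sub_mem (K := Ideal.ofList (diffVars k n))
      ((rename Sum.inl).comp (specialization k n)) (fun v => ?_) (f - g)
    · simpa [hgf] using this
    · rcases v with i | i
      · simp [specialization]
      · rw [← neg_sub]
        refine neg_mem (Ideal.subset_span (List.mem_ofFn.mpr ⟨i, ?_⟩))
        simp [specialization]
  · refine sup_le (fun f hf => ?_) (Ideal.span_le.mpr fun r hr => ?_)
    · exact Ideal.Quotient.eq_zero_iff_mem.mpr (Ideal.mem_map_of_mem _ hf)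
    · obtain ⟨i, rfl⟩ := List.mem_ofFn.mp hr
      simp [specialization]

end RegularSequence

/-! ### Regular sequences over Noetherian local rings -/

section LocalAlgebra

open IsLocalRing RingTheory.Sequence Pointwise

universe u

/-- There is an `M`-regular sequence of length `r` in the maximal ideal. -/
def HasRegularSequence (A : Type*) [CommRing A] [IsLocalRing A] (M : Type*) [AddCommGroup M]
    [Module A M] (r : ℕ) : Prop :=
  ∃ rs : List A, rs.length = r ∧ (∀ x ∈ rs, x ∈ maximalIdeal A) ∧ IsRegular M rs

variable {A : Type u} [CommRing A] [IsLocalRing A]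

lemma HasRegularSequence.congr {M N : Type*} [AddCommGroup M] [Module A M] [AddCommGroup N]
    [Module A N] (e : M ≃ₗ[A] N) {r : ℕ} :
    HasRegularSequence A M r ↔ HasRegularSequence A N r :=
  exists_congr fun rs => and_congr_right fun _ => and_congr_right fun _ => e.isRegular_congr rs

lemma HasRegularSequence.of_quotSMulTop {M : Type*} [AddCommGroup M] [Module A M] {x : A}
    (hx : x ∈ maximalIdeal A) (hreg : IsSMulRegular M x) {r : ℕ}
    (h : HasRegularSequence A (QuotSMulTop x M) r) : HasRegularSequence A M (r + 1) := by
  obtain ⟨rs, hlen, hmem, hrs⟩ := h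
  exact ⟨x :: rs, by simp [hlen], List.forall_mem_cons.mpr ⟨hx, hmem⟩,
    (isRegular_cons_iff M x rs).mpr ⟨hreg, hrs⟩⟩

variable [IsNoetherianRing A]

/-- Passing to the quotient by a regular element lowers the length of a regular sequence by one.
By the Rees theorem the lengths are detected by the vanishing of `Ext` from the residue field. -/
lemma HasRegularSequence.quotSMulTop {M : Type u} [AddCommGroup M] [Module A M]
    [Module.Finite A M] {x : A} (hx : x ∈ maximalIdeal A) (hreg : IsSMulRegular M x) {r : ℕ}
    (h : HasRegularSequence A M (r + 1)) : HasRegularSequence A (QuotSMulTop x M) r := by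
  obtain ⟨rs, hlen, hmem, hrs⟩ := h
  have hM : Nontrivial M := hrs.nontrivial
  have hQ : Nontrivial (QuotSMulTop x M) := nontrivial_quotSMulTop_of_mem_maximalIdeal M hx
  have lt : ∀ (N : Type u) [AddCommGroup N] [Module A N] [Module.Finite A N] [Nontrivial N],
      maximalIdeal A • (⊤ : Submodule A N) < ⊤ := fun N _ _ _ _ =>
    (Submodule.top_ne_ideal_smul_of_le_jacobson_annihilator
      (maximalIdeal_le_jacobson _)).symm.lt_top
  have hsupp : Module.support A (ModuleCat.of A (A ⧸ maximalIdeal A)) =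
      PrimeSpectrum.zeroLocus (maximalIdeal A) := by
    rw [Module.support_eq_zeroLocus, Ideal.annihilator_quotient]
  have hext := ModuleCat.subsingleton_ext_of_exists_isRegular (maximalIdeal A)
    (ModuleCat.of A (A ⧸ maximalIdeal A)) hsupp.subset (ModuleCat.of A M) (lt M) rs hmem hrs
  rw [hlen] at hext
  obtain ⟨rs', h1, h2, h3⟩ := ModuleCat.exists_isRegular_of_exists_subsingleton_ext
    (maximalIdeal A) r (ModuleCat.of A (QuotSMulTop x M)) (lt _)
    (ModuleCat.of A (A ⧸ maximalIdeal A)) hsupp fun i hi => by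
      have zero1 := AddCommGrpCat.isZero_of_iff_subsingleton.mpr (hext i (by omega))
      have zero2 := AddCommGrpCat.isZero_of_iff_subsingleton.mpr (hext (i + 1) (by omega))
      have hreg' : IsSMulRegular (ModuleCat.of A M) x := hreg
      exact AddCommGrpCat.subsingleton_of_isZero <|
        CategoryTheory.ShortComplex.Exact.isZero_of_both_zeros
        (CategoryTheory.Abelian.Ext.covariant_sequence_exact₃' _
          hreg'.smulShortComplex_shortExact i (i + 1) rfl)
        (zero1.eq_zero_of_src _) (zero2.eq_zero_of_tgt _)
  exact ⟨rs', h1, h2, h3⟩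

lemma hasRegularSequence_quotient_iff {M : Type u} [AddCommGroup M] [Module A M]
    [Module.Finite A M] {rs : List A} (hmem : ∀ x ∈ rs, x ∈ maximalIdeal A)
    (hrs : IsWeaklyRegular M rs) (r : ℕ) :
    HasRegularSequence A (M ⧸ (Ideal.ofList rs • ⊤ : Submodule A M)) r ↔
      HasRegularSequence A M (r + rs.length) := by
  induction rs generalizing M with
  | nil =>
    rw [Ideal.ofList_nil, Submodule.bot_smul]
    exact HasRegularSequence.congr (Submodule.quotEquivOfEqBot ⊥ rfl)
  | cons x rs ih =>
    rw [isWeaklyRegular_cons_iff] at hrs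
    have hx := hmem x (by simp)
    rw [HasRegularSequence.congr (Submodule.quotOfListConsSMulTopEquivQuotSMulTopInner M x rs),
      ih (fun y hy => hmem y (by simp [hy])) hrs.2, List.length_cons, ← add_assoc]
    exact ⟨.of_quotSMulTop hx hrs.1, .quotSMulTop hx hrs.1⟩

/-- A nonzero element whose annihilator contains `p` can be divided by a regular element `x` until
its image in `M / x M` is nonzero; this produces an associated prime of `M / x M` above `p` and
`x`. -/
lemma exists_isAssociatedPrime_quotSMulTop {M : Type*} [AddCommGroup M] [Module A M]
    [Module.Finite A M] {x : A} (hx : x ∈ maximalIdeal A) (hreg : IsSMulRegular M x)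
    {p : Ideal A} (hp : IsAssociatedPrime p M) :
    ∃ q, IsAssociatedPrime q (QuotSMulTop x M) ∧ p ≤ q ∧ x ∈ q := by
  obtain ⟨hpp, y, hy⟩ := isAssociatedPrime_iff.mp hp
  have hmem : ∀ (m : M) a, a ∈ (⊥ : Submodule A M).colon {m} ↔ a • m = 0 := fun m a => by
    rw [Submodule.mem_colon_singleton, Submodule.mem_bot]
  -- The submodule of elements killed by `p`.
  let N : Submodule A M :=
    { carrier := {m | ∀ a ∈ p, a • m = 0}
      add_mem' := fun h1 h2 a ha => by rw [smul_add, h1 a ha, h2 a ha, add_zero]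
      zero_mem' := fun a _ => smul_zero a
      smul_mem' := fun c m h a ha => by rw [smul_comm, h a ha, smul_zero] }
  have hyN : y ∈ N := fun a ha => (hmem y a).mp (hy ▸ ha)
  have hy0 : y ≠ 0 := by
    rintro rfl
    apply hpp.ne_top
    rw [hy, Ideal.eq_top_iff_one, hmem, smul_zero]
  obtain ⟨m, hmN, hm⟩ : ∃ m ∈ N, m ∉ (x • ⊤ : Submodule A M) := by
    by_contra! hcon
    have hN : N ≤ maximalIdeal A • N := by
      intro m hm
      obtain ⟨m', -, rfl⟩ := (Submodule.mem_smul_pointwise_iff_exists _ _ _).mp (hcon m hm)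
      refine Submodule.smul_mem_smul hx fun a ha => hreg ?_
      simp only [smul_zero]
      rw [smul_comm]
      exact hm a ha
    have := Submodule.eq_bot_of_le_smul_of_le_jacobson_bot (maximalIdeal A) N
      (IsNoetherian.noetherian N) hN (maximalIdeal_le_jacobson ⊥)
    rw [this] at hyN
    exact hy0 hyN
  obtain ⟨q, hq, hle⟩ := exists_le_isAssociatedPrime_of_isNoetherianRing A
    (Submodule.Quotient.mk m : QuotSMulTop x M) (by rwa [Ne, Submodule.Quotient.mk_eq_zero])
  refine ⟨q, hq, fun a ha => hle ?_, hle ?_⟩ <;>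
    rw [Submodule.mem_colon_singleton, Submodule.mem_bot, ← Submodule.Quotient.mk_smul]
  · rw [hmN a ha, Submodule.Quotient.mk_zero]
  · rw [Submodule.Quotient.mk_eq_zero]
    exact Submodule.smul_mem_pointwise_smul _ _ _ trivial

/-- The length of a regular sequence on `M` is at most the dimension of `A ⧸ p`, for every
associated prime `p` of `M`. -/
lemma HasRegularSequence.le_ringKrullDim_quotient {M : Type u} [AddCommGroup M] [Module A M]
    [Module.Finite A M] {r : ℕ} (h : HasRegularSequence A M r) {p : Ideal A}
    (hp : IsAssociatedPrime p M) : (r : WithBot ℕ∞) ≤ ringKrullDim (A ⧸ p) := by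
  induction r generalizing M p with
  | zero =>
    have := hp.isPrime
    exact_mod_cast ringKrullDim_nonneg_of_nontrivial
  | succ r ih =>
    obtain ⟨rs, hlen, hmem, hrs⟩ := h
    obtain _ | ⟨x, rs⟩ := rs
    · simp at hlen
    have hreg := ((isRegular_cons_iff M x rs).mp hrs).1
    have hx := hmem x (by simp)
    obtain ⟨q, hq, hpq, hxq⟩ := exists_isAssociatedPrime_quotSMulTop hx hreg hp
    have h1 := ih (M := QuotSMulTop x M)
      ⟨rs, by simpa using hlen, fun y hy => hmem y (by simp [hy]),
        ((isRegular_cons_iff M x rs).mp hrs).2⟩ hq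
    have hxp : x ∉ p := fun hxp => by
      have : x ∈ ⋃ p ∈ associatedPrimes A M, (p : Set A) := Set.mem_biUnion hp hxp
      rw [biUnion_associatedPrimes_eq_compl_regular] at this
      exact this hreg
    have := hp.isPrime
    have h2 := ringKrullDim_succ_le_of_surjective (Ideal.Quotient.factor hpq)
      (Ideal.Quotient.factor_surjective hpq) (r := Ideal.Quotient.mk p x)
      (mem_nonZeroDivisors_of_ne_zero (by rwa [Ne, Ideal.Quotient.eq_zero_iff_mem]))
      (by rwa [Ideal.Quotient.factor_mk, Ideal.Quotient.eq_zero_iff_mem])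
    calc ((r + 1 : ℕ) : WithBot ℕ∞) = r + 1 := by push_cast; rfl
      _ ≤ ringKrullDim (A ⧸ q) + 1 := by gcongr
      _ ≤ _ := h2

/-- If the maximal ideal is the radical of `I + (x₁, …, x_d)`, then `dim A ⧸ I ≤ d`. -/
lemma ringKrullDim_quotient_le_length {I : Ideal A} {xs : List A}
    (hmem : ∀ x ∈ xs, x ∈ maximalIdeal A)
    (h : maximalIdeal A ≤ (I ⊔ Ideal.ofList xs).radical) :
    ringKrullDim (A ⧸ I) ≤ xs.length := by
  classical
  rcases subsingleton_or_nontrivial (A ⧸ I) with hI | hI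
  · rw [ringKrullDim_eq_bot_of_subsingleton]
    exact bot_le
  have hloc : IsLocalRing (A ⧸ I) :=
    .of_surjective' (Ideal.Quotient.mk I) Ideal.Quotient.mk_surjective
  have hmax : (maximalIdeal (A ⧸ I)).comap (Ideal.Quotient.mk I) = maximalIdeal A :=
    ((local_hom_TFAE (Ideal.Quotient.mk I)).out 0 4).mp
      (IsLocalHom.of_surjective _ Ideal.Quotient.mk_surjective)
  rw [← maximalIdeal_height_eq_ringKrullDim]
  have hmin : maximalIdeal (A ⧸ I) ∈
      (Ideal.span ((xs.map (Ideal.Quotient.mk I)).toFinset : Set (A ⧸ I))).minimalPrimes := by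
    refine ⟨⟨inferInstance, Ideal.span_le.mpr fun y hy => ?_⟩, fun q ⟨hq, hle⟩ _ y hy => ?_⟩
    · obtain ⟨x, hx, rfl⟩ := List.mem_map.mp (List.mem_toFinset.mp hy)
      have := hmem x hx
      rwa [← hmax] at this
    · obtain ⟨a, rfl⟩ := Ideal.Quotient.mk_surjective y
      have ha : a ∈ maximalIdeal A := by
        rw [← hmax]
        exact hy
      have hq' : (I ⊔ Ideal.ofList xs).radical ≤ q.comap (Ideal.Quotient.mk I) := by
        refine (Ideal.IsPrime.radical_le_iff inferInstance).mpr
          (sup_le (fun b hb => ?_) (Ideal.span_le.mpr fun x hx => ?_))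
        · rw [Ideal.mem_comap, Ideal.Quotient.eq_zero_iff_mem.mpr hb]
          exact zero_mem _
        · exact hle (Ideal.subset_span (List.mem_toFinset.mpr (List.mem_map_of_mem hx)))
      exact hq' (h ha)
  have h1 := Ideal.height_le_card_of_mem_minimalPrimes_span_finset hmin
  have h2 := (xs.map (Ideal.Quotient.mk I)).toFinset_card_le
  rw [List.length_map] at h2
  calc ((maximalIdeal (A ⧸ I)).height : WithBot ℕ∞)
      ≤ ((xs.map (Ideal.Quotient.mk I)).toFinset.card : ℕ∞) := by exact_mod_cast h1
    _ ≤ xs.length := by exact_mod_cast h2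

/-- If `M` has a regular sequence of length `d`, then every sequence of `d` elements of the maximal
ideal for which `M / (x₁, …, x_d) M` is supported at the closed point is `M`-regular. -/
lemma HasRegularSequence.isWeaklyRegular_of_le_radical {M : Type u} [AddCommGroup M] [Module A M]
    [Module.Finite A M] {xs : List A} (h : HasRegularSequence A M xs.length)
    (hmem : ∀ x ∈ xs, x ∈ maximalIdeal A)
    (hrad : maximalIdeal A ≤ (Module.annihilator A M ⊔ Ideal.ofList xs).radical) :
    IsWeaklyRegular M xs := by
  induction xs generalizing M with
  | nil => exact .nil A M
  | cons x xs ih =>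
    have hx := hmem x (by simp)
    have hreg : IsSMulRegular M x := by
      by_contra hcon
      have : x ∈ ⋃ p ∈ associatedPrimes A M, (p : Set A) := by
        rw [biUnion_associatedPrimes_eq_compl_regular]
        exact hcon
      obtain ⟨p, hp, hxp⟩ := Set.mem_iUnion₂.mp this
      have h1 := h.le_ringKrullDim_quotient hp
      have h2 := ringKrullDim_quotient_le_length (I := p) (xs := xs)
        (fun y hy => hmem y (by simp [hy])) (hrad.trans (Ideal.radical_mono ?_))
      · have := h1.trans h2
        rw [List.length_cons] at this
        norm_cast at this
        omega
      · rw [Ideal.ofList_cons, ← sup_assoc]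
        refine sup_le_sup_right (sup_le ?_ ((Ideal.span_singleton_le_iff_mem p).mpr hxp)) _
        have := IsAssociatedPrime.annihilator_le hp
        rwa [Submodule.annihilator_top] at this
    rw [isWeaklyRegular_cons_iff]
    refine ⟨hreg, ih (h.quotSMulTop hx hreg) (fun y hy => hmem y (by simp [hy]))
      (hrad.trans (Ideal.radical_mono ?_))⟩
    rw [Ideal.ofList_cons, ← sup_assoc]
    refine sup_le_sup_right (sup_le (fun a ha => ?_)
      ((Ideal.span_singleton_le_iff_mem _).mpr ?_)) _ <;> rw [Module.mem_annihilator] at *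
    · intro m
      obtain ⟨m, rfl⟩ := Submodule.Quotient.mk_surjective _ m
      rw [← Submodule.Quotient.mk_smul, ha, Submodule.Quotient.mk_zero]
    · intro m
      obtain ⟨m, rfl⟩ := Submodule.Quotient.mk_surjective _ m
      rw [← Submodule.Quotient.mk_smul, Submodule.Quotient.mk_eq_zero]
      exact Submodule.smul_mem_pointwise_smul _ _ _ trivial

end LocalAlgebra

/-! ### Depth and quotients by regular sequences -/

section LocalAlgebra

open IsLocalRing RingTheory.Sequence

universe u

lemma exists_ringKrullDim_eq_natCast (A : Type*) [CommRing A] [IsLocalRing A]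
    [IsNoetherianRing A] : ∃ d : ℕ, ringKrullDim A = d := by
  obtain ⟨d, hd⟩ := WithBot.ne_bot_iff_exists.mp (ringKrullDim_ne_bot (R := A))
  have hlt : ringKrullDim A < ⊤ := ringKrullDim_lt_top
  rw [← hd] at hlt ⊢
  obtain ⟨n, hn⟩ := ENat.ne_top_iff_exists.mp (show d ≠ ⊤ by rintro rfl; exact hlt.ne rfl)
  exact ⟨n, by rw [← hn]; rfl⟩

lemma HasRegularSequence.le_ringKrullDim {A : Type*} [CommRing A] [IsLocalRing A]
    [IsNoetherianRing A] {r : ℕ} (h : HasRegularSequence A A r) :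
    (r : WithBot ℕ∞) ≤ ringKrullDim A := by
  obtain ⟨rs, rfl, hmem, hrs⟩ := h
  rw [← ringKrullDim_add_length_eq_ringKrullDim_of_isRegular rs hrs]
  have : Nontrivial (A ⧸ Ideal.ofList rs) := Ideal.Quotient.nontrivial_iff.mpr fun h => by
    refine (maximalIdeal.isMaximal A).ne_top (top_le_iff.mp (h ▸ Ideal.span_le.mpr hmem))
  calc ((rs.length : ℕ) : WithBot ℕ∞) = 0 + rs.length := by rw [zero_add]
    _ ≤ _ := by gcongr; exact ringKrullDim_nonneg_of_nontrivial

/-- The depth equals the dimension if and only if some regular sequence has length equal to the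
dimension. -/
lemma localRingDepth_eq_iff {A : Type*} [CommRing A] [IsLocalRing A] [IsNoetherianRing A] :
    (localRingDepth A : WithBot ℕ∞) = ringKrullDim A ↔
      ∃ r : ℕ, HasRegularSequence A A r ∧ ringKrullDim A = r := by
  constructor
  · intro h
    have hlt : localRingDepth A < ⊤ := by
      obtain ⟨d, hd⟩ := exists_ringKrullDim_eq_natCast A
      rw [hd] at h
      have : localRingDepth A = (d : ℕ∞) := WithBot.coe_injective h
      rw [this]
      exact ENat.natCast_lt_top d
    rw [localRingDepth, iSup_subtype'] at hlt
    have : Nonempty {rs : List A | (∀ r ∈ rs, r ∈ maximalIdeal A) ∧ IsRegular A rs} :=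
      ⟨⟨[], by simp, .nil A A⟩⟩
    obtain ⟨⟨rs, hmem, hrs⟩, h'⟩ := ENat.exists_eq_iSup_of_lt_top hlt
    refine ⟨rs.length, ⟨rs, rfl, hmem, hrs⟩, ?_⟩
    rw [← h, localRingDepth, iSup_subtype', ← h']
    rfl
  · rintro ⟨r, hr, hdim⟩
    rw [hdim]
    suffices localRingDepth A = r by
      rw [this]
      rfl
    apply le_antisymm
    · refine iSup₂_le fun rs hrs => ?_
      have := HasRegularSequence.le_ringKrullDim (A := A) ⟨rs, rfl, hrs⟩
      rw [hdim] at this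
      exact_mod_cast this
    · obtain ⟨rs, rfl, hrs⟩ := hr
      exact le_iSup₂_of_le rs hrs le_rfl

lemma hasRegularSequence_iff_of_surjective {A C : Type*} [CommRing A] [CommRing C] [IsLocalRing A]
    [IsLocalRing C] (f : A →+* C) (hf : Function.Surjective f) (r : ℕ) :
    HasRegularSequence C C r ↔ HasRegularSequence A (A ⧸ RingHom.ker f) r := by
  let := f.toAlgebra
  have hcomap : (maximalIdeal C).comap f = maximalIdeal A :=
    ((local_hom_TFAE f).out 0 4).mp (IsLocalHom.of_surjective f hf)
  have hmax : ∀ x, f x ∈ maximalIdeal C ↔ x ∈ maximalIdeal A := fun x => by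
    rw [← hcomap, Ideal.mem_comap]
  let e : (A ⧸ RingHom.ker f) ≃ₗ[A] C :=
    (Ideal.quotientKerAlgEquivOfSurjective (f := Algebra.ofId A C) hf).toLinearEquiv
  have hfin : Module.Finite A C := .of_surjective (Algebra.linearMap A C) hf
  rw [HasRegularSequence.congr e]
  constructor
  · rintro ⟨rs, hlen, hmem, hrs⟩
    obtain ⟨rs, rfl⟩ := List.map_surjective_iff.mpr hf rs
    have hmem' : ∀ x ∈ rs, x ∈ maximalIdeal A := fun x hx =>
      (hmax x).mp (hmem _ (List.mem_map_of_mem hx))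
    exact ⟨rs, by simpa using hlen, hmem', .of_isWeaklyRegular_of_mem_maximalIdeal C hmem'
      ((isWeaklyRegular_map_algebraMap_iff (S := C) C rs).mp hrs.toIsWeaklyRegular)⟩
  · rintro ⟨rs, hlen, hmem, hrs⟩
    have hmem' : ∀ x ∈ rs.map f, x ∈ maximalIdeal C := by
      simpa only [List.forall_mem_map, hmax] using hmem
    exact ⟨rs.map f, by simpa using hlen, hmem', .of_isWeaklyRegular_of_mem_maximalIdeal C hmem'
      ((isWeaklyRegular_map_algebraMap_iff (S := C) C rs).mpr hrs.toIsWeaklyRegular)⟩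

/-- A Noetherian local ring has depth equal to its dimension if and only if its quotient by a
regular sequence has. -/
lemma localRingDepth_eq_iff_of_surjective {A C : Type u} [CommRing A] [CommRing C] [IsLocalRing A]
    [IsNoetherianRing A] [IsLocalRing C] [IsNoetherianRing C] (f : A →+* C)
    (hf : Function.Surjective f) {rs : List A} (hmem : ∀ x ∈ rs, x ∈ maximalIdeal A)
    (hrs : IsWeaklyRegular A rs) (hker : RingHom.ker f = Ideal.ofList rs) :
    (localRingDepth A : WithBot ℕ∞) = ringKrullDim A ↔
      (localRingDepth C : WithBot ℕ∞) = ringKrullDim C := by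
  have key : ∀ r, HasRegularSequence C C r ↔ HasRegularSequence A A (r + rs.length) := fun r => by
    rw [hasRegularSequence_iff_of_surjective f hf, ← hasRegularSequence_quotient_iff hmem hrs]
    exact HasRegularSequence.congr (Submodule.quotEquivOfEq _ _ (by simp [hker]))
  have hdim : ringKrullDim C + rs.length = ringKrullDim A := by
    rw [← ringKrullDim_add_length_eq_ringKrullDim_of_isRegular rs
      (.of_isWeaklyRegular_of_mem_maximalIdeal A hmem hrs), ← hker,
      ringKrullDim_eq_of_ringEquiv (RingHom.quotientKerEquivOfSurjective hf)]
  rw [localRingDepth_eq_iff, localRingDepth_eq_iff]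
  constructor
  · rintro ⟨r, hr, hdr⟩
    obtain ⟨d, hd⟩ : ∃ d : ℕ, ringKrullDim C = d := exists_ringKrullDim_eq_natCast C
    have hrd : r = d + rs.length := by
      rw [hd, hdr] at hdim
      exact_mod_cast hdim.symm
    exact ⟨d, (key d).mpr (hrd ▸ hr), hd⟩
  · rintro ⟨r, hr, hdr⟩
    refine ⟨r + rs.length, (key r).mp hr, ?_⟩
    rw [← hdim, hdr]
    norm_cast

end LocalAlgebra

section Localization

open RingTheory.Sequence

universe u

/-- Let `B → C` be surjective with kernel generated by a regular sequence. Localizing at a prime of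
`C` and at its preimage, depth equals dimension for the one if and only if for the other. -/
lemma localRingDepth_localization_eq_iff {B C : Type u} [CommRing B] [CommRing C]
    [IsNoetherianRing B] (f : B →+* C) (hf : Function.Surjective f) {rs : List B}
    (hrs : IsWeaklyRegular B rs) (hker : RingHom.ker f = Ideal.ofList rs) (P : Ideal B)
    [P.IsPrime] (Q : Ideal C) [Q.IsPrime] (hPQ : P = Q.comap f) :
    (localRingDepth (Localization.AtPrime P) : WithBot ℕ∞) =
        ringKrullDim (Localization.AtPrime P) ↔
      (localRingDepth (Localization.AtPrime Q) : WithBot ℕ∞) =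
        ringKrullDim (Localization.AtPrime Q) := by
  have hC : IsNoetherianRing C := isNoetherianRing_of_surjective B C f hf
  have := IsLocalization.isNoetherianRing P.primeCompl (Localization.AtPrime P) inferInstance
  have := IsLocalization.isNoetherianRing Q.primeCompl (Localization.AtPrime Q) inferInstance
  set φ := Localization.localRingHom P Q f hPQ with hφ
  have hmem : ∀ x ∈ rs, x ∈ P := fun x hx => by
    have h : x ∈ RingHom.ker f := hker ▸ Ideal.subset_span hx
    rw [hPQ, Ideal.mem_comap, (RingHom.mem_ker).mp h]
    exact zero_mem _
  refine localRingDepth_eq_iff_of_surjective φ ?_ (rs := rs.map (algebraMap B _)) ?_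
    (hrs.of_isLocalization _ P.primeCompl) ?_
  · intro y
    obtain ⟨c, s, rfl⟩ := IsLocalization.exists_mk'_eq Q.primeCompl y
    obtain ⟨b, rfl⟩ := hf c
    obtain ⟨t, ht⟩ := hf s
    have htP : t ∈ P.primeCompl := fun h => s.2 (by rw [← ht]; rw [hPQ] at h; exact h)
    refine ⟨IsLocalization.mk' _ b ⟨t, htP⟩, ?_⟩
    rw [hφ, Localization.localRingHom_mk']
    congr 1
    exact Subtype.ext ht
  · simp only [List.forall_mem_map]
    intro x hx
    exact (IsLocalization.AtPrime.to_map_mem_maximal_iff _ P x).mpr (hmem x hx)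
  · rw [← Ideal.map_ofList, ← hker]
    apply le_antisymm
    · intro y hy
      obtain ⟨b, s, rfl⟩ := IsLocalization.exists_mk'_eq P.primeCompl y
      rw [RingHom.mem_ker, hφ, Localization.localRingHom_mk', IsLocalization.mk'_eq_zero_iff] at hy
      obtain ⟨c, hc⟩ := hy
      obtain ⟨t, ht⟩ := hf c
      have htP : t ∈ P.primeCompl := fun h => c.2 (by rw [← ht]; rw [hPQ] at h; exact h)
      rw [IsLocalization.mk'_mem_map_algebraMap_iff]
      exact ⟨t, htP, by rw [RingHom.mem_ker, map_mul, ht, hc]⟩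
    · refine Ideal.map_le_iff_le_comap.mpr fun b hb => ?_
      rw [Ideal.mem_comap, RingHom.mem_ker, hφ, Localization.localRingHom_to_map,
        RingHom.mem_ker.mp hb, map_zero]

end Localization

/-! ### Leading forms and regular sequences -/

section Graded

open MvPolynomial RingTheory.Sequence

attribute [local instance] MvPolynomial.gradedAlgebra

lemma RingTheory.Sequence.isWeaklyRegular_quotient_cons_iff {R : Type*} [CommRing R] (I : Ideal R)
    (r : R) (rs : List R) : IsWeaklyRegular (R ⧸ I) (r :: rs) ↔
      (∀ f, r * f ∈ I → f ∈ I) ∧ IsWeaklyRegular (R ⧸ (I ⊔ Ideal.span {r})) rs := by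
  rw [isWeaklyRegular_quotient_iff, isWeaklyRegular_quotient_iff]
  constructor
  · refine fun h => ⟨fun f hf => ?_, fun i hi f hf => ?_⟩
    · simpa using h 0 (by simp) f (by simpa using hf)
    · have := h (i + 1) (by simpa using hi) f
      simp only [List.getElem_cons_succ, List.take_succ_cons, Ideal.ofList_cons,
        ← sup_assoc] at this
      exact this hf
  · rintro ⟨h0, h⟩ i hi f hf
    obtain _ | i := i
    · simpa using h0 f (by simpa using hf)
    · simp only [List.getElem_cons_succ, List.take_succ_cons, Ideal.ofList_cons,
        ← sup_assoc] at hf ⊢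
      exact h i (by simpa using hi) f hf

lemma RingTheory.Sequence.isWeaklyRegular_self_iff {R : Type*} [CommRing R] (rs : List R) :
    IsWeaklyRegular R rs ↔ ∀ (i : ℕ) (hi : i < rs.length) (f : R),
      rs[i] * f ∈ Ideal.ofList (rs.take i) → f ∈ Ideal.ofList (rs.take i) := by
  rw [isWeaklyRegular_iff]
  refine forall₂_congr fun i hi => ?_
  rw [isSMulRegular_quotient_iff_mem_of_smul_mem]
  simp only [smul_eq_mul, Ideal.mul_top]

variable {σ k : Type*} [Field k]

lemma MvPolynomial.homogeneousComponent_mul_of_isHomogeneous {F : MvPolynomial σ k} {d : ℕ}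
    (hF : F.IsHomogeneous d) (f : MvPolynomial σ k) (n : ℕ) :
    homogeneousComponent n (F * f) =
      if d ≤ n then F * homogeneousComponent (n - d) f else 0 := by
  have h : ∀ (p : MvPolynomial σ k) (i : ℕ),
      (DirectSum.decompose (homogeneousSubmodule σ k) p i : MvPolynomial σ k) =
        homogeneousComponent i p := fun p i => decomposition.decompose'_apply p i
  have := DirectSum.coe_decompose_mul_of_left_mem (homogeneousSubmodule σ k) n
    ((mem_homogeneousSubmodule d F).mpr hF) (b := f)
  rwa [h, h] at this

lemma MvPolynomial.homogeneousComponent_mul_of_totalDegree_le {P f : MvPolynomial σ k} {a b : ℕ}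
    (hP : P.totalDegree ≤ a) (hf : f.totalDegree ≤ b) :
    homogeneousComponent (a + b) (P * f) =
      homogeneousComponent a P * homogeneousComponent b f := by
  conv_lhs => rw [← P.sum_homogeneousComponent, Finset.sum_mul, map_sum]
  simp only [homogeneousComponent_mul_of_isHomogeneous (homogeneousComponent_isHomogeneous _ P)]
  rw [Finset.sum_eq_single a]
  · simp
  · intro i hi hia
    have hi' : i < a := by
      have := Finset.mem_range.mp hi
      omega
    rw [if_pos (by omega), homogeneousComponent_eq_zero _ f (by omega), mul_zero]
  · intro ha
    have : P.totalDegree < a := by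
      have := Finset.mem_range.not.mp ha
      omega
    rw [homogeneousComponent_eq_zero _ P this, zero_mul, ite_self]

lemma MvPolynomial.eq_zero_or_totalDegree_le_of_homogeneousComponent_eq_zero
    {f : MvPolynomial σ k} {n : ℕ} (hf : f.totalDegree ≤ n) (h : homogeneousComponent n f = 0) :
    f = 0 ∨ ∃ m, n = m + 1 ∧ f.totalDegree ≤ m := by
  rcases hf.lt_or_eq with hlt | rfl
  · exact Or.inr ⟨n - 1, by omega, by omega⟩
  · rcases Nat.eq_zero_or_eq_succ_pred f.totalDegree with h0 | h0
    · left
      have := f.sum_homogeneousComponent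
      rw [h0] at this h
      rw [← this, Finset.sum_range_one, h]
    · right
      refine ⟨_, h0, ?_⟩
      have hsum := f.sum_homogeneousComponent
      rw [Finset.sum_range_succ, h, add_zero] at hsum
      refine (congrArg totalDegree hsum).symm.trans_le
        ((totalDegree_finsetSum _ _).trans (Finset.sup_le fun i hi => ?_))
      have := Finset.mem_range.mp hi
      exact (homogeneousComponent_isHomogeneous i f).totalDegree_le.trans (by omega)

/-- `I` is the ideal generated by the leading forms (the components of top degree) of the elements
of `J`. -/
structure IsLeadingIdeal (J I : Ideal (MvPolynomial σ k)) : Prop where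
  leading_mem : ∀ (n : ℕ), ∀ f ∈ J, f.totalDegree ≤ n → homogeneousComponent n f ∈ I
  exists_lift : ∀ f ∈ I, ∀ (n : ℕ), ∃ g ∈ J, g.totalDegree ≤ n ∧
    homogeneousComponent n g = homogeneousComponent n f

lemma IsLeadingIdeal.refl {J : Ideal (MvPolynomial σ k)}
    (hJ : J.IsHomogeneous (homogeneousSubmodule σ k)) : IsLeadingIdeal J J where
  leading_mem n _ hf _ := homogeneousComponent_mem_of_mem hJ hf n
  exists_lift f hf n := ⟨_, homogeneousComponent_mem_of_mem hJ hf n,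
    (homogeneousComponent_isHomogeneous n f).totalDegree_le,
    homogeneousComponent_eq_self (homogeneousComponent_isHomogeneous n f)⟩

/-- An element whose leading form lies in the leading ideal of `J` can be reduced in degree modulo
`J`. -/
lemma IsLeadingIdeal.exists_reduction {J I : Ideal (MvPolynomial σ k)} (h : IsLeadingIdeal J I)
    {f : MvPolynomial σ k} {n : ℕ} (hf : f.totalDegree ≤ n)
    (hlead : homogeneousComponent n f ∈ I) :
    ∃ g ∈ J, f - g = 0 ∨ ∃ m, n = m + 1 ∧ (f - g).totalDegree ≤ m := by
  obtain ⟨g, hg, hdeg, hgf⟩ := h.exists_lift _ hlead n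
  rw [homogeneousComponent_eq_self (homogeneousComponent_isHomogeneous n f)] at hgf
  exact ⟨g, hg, eq_zero_or_totalDegree_le_of_homogeneousComponent_eq_zero
    ((totalDegree_sub f g).trans (max_le hf hdeg)) (by rw [map_sub, hgf, sub_self])⟩

/-- If the leading form of `P` is a nonzerodivisor modulo the leading ideal of `J`, then `P` is a
nonzerodivisor modulo `J`. -/
lemma IsLeadingIdeal.mem_of_mul_mem {J I : Ideal (MvPolynomial σ k)} (h : IsLeadingIdeal J I)
    {P : MvPolynomial σ k} {d : ℕ} (hP : P.totalDegree ≤ d)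
    (hreg : ∀ f, homogeneousComponent d P * f ∈ I → f ∈ I) {f : MvPolynomial σ k}
    (hf : P * f ∈ J) : f ∈ J := by
  induction hn : f.totalDegree using Nat.strong_induction_on generalizing f with
  | _ n ih =>
  have h1 := h.leading_mem (d + n) _ hf
    ((totalDegree_mul P f).trans (add_le_add hP hn.le))
  rw [homogeneousComponent_mul_of_totalDegree_le hP hn.le] at h1
  obtain ⟨g, hg, h0 | ⟨m, rfl, hm⟩⟩ := h.exists_reduction hn.le (hreg _ h1)
  · rwa [sub_eq_zero.mp h0]
  · have hPg : P * (f - g) ∈ J := by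
      rw [mul_sub]
      exact sub_mem hf (J.mul_mem_left P hg)
    have := ih _ (by omega) hPg rfl
    rw [← sub_add_cancel f g]
    exact add_mem this hg

/-- If the leading form of `P` is a nonzerodivisor modulo the leading ideal of `J`, then the leading
ideal of `J + (P)` is obtained by adding the leading form of `P`. -/
lemma IsLeadingIdeal.sup_span_singleton {J I : Ideal (MvPolynomial σ k)} (h : IsLeadingIdeal J I)
    {P : MvPolynomial σ k} {d : ℕ} (hP : P.totalDegree ≤ d)
    (hreg : ∀ f, homogeneousComponent d P * f ∈ I → f ∈ I) :
    IsLeadingIdeal (J ⊔ Ideal.span {P}) (I ⊔ Ideal.span {homogeneousComponent d P}) where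
  leading_mem n w hw hwn := by
    obtain ⟨u, hu, y, hy, rfl⟩ := Submodule.mem_sup.mp hw
    obtain ⟨v, rfl⟩ := Ideal.mem_span_singleton'.mp hy
    clear hw hy
    induction hN : v.totalDegree using Nat.strong_induction_on generalizing u v with
    | _ N ih =>
    have hPv := (totalDegree_mul v P).trans (add_le_add hN.le hP)
    by_cases hle : N + d ≤ n
    · have hun : u.totalDegree ≤ n := by
        rw [← add_sub_cancel_right u (v * P)]
        exact (totalDegree_sub _ _).trans (max_le hwn (hPv.trans hle))
      rw [map_add]
      refine add_mem (Ideal.mem_sup_left (h.leading_mem n u hu hun)) (Ideal.mem_sup_right ?_)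
      have hv : v.totalDegree ≤ n - d := by omega
      rw [show n = (n - d) + d by omega, homogeneousComponent_mul_of_totalDegree_le hv hP]
      exact Ideal.mul_mem_left _ _ (Ideal.mem_span_singleton_self _)
    · -- The leading forms of `u` and `v * P` cancel, so that `v` can be reduced modulo `J`.
      have hcomp : homogeneousComponent (N + d) (u + v * P) = 0 :=
        homogeneousComponent_eq_zero _ _ (by omega)
      have hun : u.totalDegree ≤ N + d := by
        rw [← add_sub_cancel_right u (v * P)]
        exact (totalDegree_sub _ _).trans (max_le (by omega) hPv)
      rw [map_add, homogeneousComponent_mul_of_totalDegree_le hN.le hP, mul_comm,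
        add_eq_zero_iff_neg_eq] at hcomp
      have hlead : homogeneousComponent N v ∈ I :=
        hreg _ (hcomp ▸ neg_mem (h.leading_mem _ u hu hun))
      obtain ⟨g, hg, hred⟩ := h.exists_reduction hN.le hlead
      have hug : u + g * P ∈ J := add_mem hu (J.mul_mem_right P hg)
      have heq : u + v * P = u + g * P + (v - g) * P := by ring
      rw [heq] at hwn ⊢
      rcases hred with h0 | ⟨m, rfl, hm⟩
      · rw [h0, zero_mul, add_zero] at hwn ⊢
        exact Ideal.mem_sup_left (h.leading_mem n _ hug hwn)
      · exact ih _ (by omega) _ hug _ hwn rfl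
  exists_lift f hf n := by
    obtain ⟨a, ha, y, hy, rfl⟩ := Submodule.mem_sup.mp hf
    obtain ⟨b, rfl⟩ := Ideal.mem_span_singleton'.mp hy
    obtain ⟨g, hg, hgdeg, hgn⟩ := h.exists_lift a ha n
    rw [map_add, mul_comm b,
      homogeneousComponent_mul_of_isHomogeneous (homogeneousComponent_isHomogeneous d P)]
    split_ifs with hdn
    · have hb : (homogeneousComponent (n - d) b).totalDegree ≤ n - d :=
        (homogeneousComponent_isHomogeneous _ b).totalDegree_le
      refine ⟨g + P * homogeneousComponent (n - d) b, add_mem (Ideal.mem_sup_left hg)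
        (Ideal.mem_sup_right (Ideal.mul_mem_right _ _ (Ideal.mem_span_singleton_self P))), ?_, ?_⟩
      · refine (totalDegree_add _ _).trans (max_le hgdeg ((totalDegree_mul _ _).trans ?_))
        omega
      · have := homogeneousComponent_mul_of_totalDegree_le hP hb
        rw [show d + (n - d) = n by omega] at this
        rw [map_add, hgn, this,
          homogeneousComponent_eq_self (homogeneousComponent_isHomogeneous _ b)]
    · exact ⟨g, Ideal.mem_sup_left hg, hgdeg, by rw [hgn, add_zero]⟩

/-- A sequence of polynomials whose leading forms are a regular sequence modulo the leading ideal
of `J` is a regular sequence modulo `J`. -/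
lemma IsLeadingIdeal.isWeaklyRegular {J I : Ideal (MvPolynomial σ k)} (h : IsLeadingIdeal J I)
    {Ps Fs : List (MvPolynomial σ k)} (hPF : List.Forall₂
      (fun P F => ∃ d, P.totalDegree ≤ d ∧ homogeneousComponent d P = F) Ps Fs)
    (hF : IsWeaklyRegular (MvPolynomial σ k ⧸ I) Fs) :
    IsWeaklyRegular (MvPolynomial σ k ⧸ J) Ps := by
  induction hPF generalizing I J with
  | nil => exact .nil _ _
  | cons hPF _ ih =>
    obtain ⟨d, hP, rfl⟩ := hPF
    rw [isWeaklyRegular_quotient_cons_iff] at hF ⊢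
    exact ⟨fun f => h.mem_of_mul_mem hP hF.1, ih (h.sup_span_singleton hP hF.1) hF.2⟩

/-- Modulo a homogeneous ideal, a polynomial with nonzero constant term is a nonzerodivisor. -/
lemma Ideal.IsHomogeneous.mem_of_mul_mem_of_constantCoeff_ne_zero {K : Ideal (MvPolynomial σ k)}
    (hK : K.IsHomogeneous (homogeneousSubmodule σ k)) {s f : MvPolynomial σ k}
    (hs : constantCoeff s ≠ 0) (h : s * f ∈ K) : f ∈ K := by
  rw [mem_iff_homogeneousComponent_mem hK]
  intro n
  induction n using Nat.strong_induction_on with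
  | _ n ih =>
  have h1 := homogeneousComponent_mem_of_mem hK h n
  rw [← s.sum_homogeneousComponent, Finset.sum_mul, map_sum,
    Finset.sum_range_succ'] at h1
  simp only [homogeneousComponent_mul_of_isHomogeneous (homogeneousComponent_isHomogeneous _ s)]
    at h1
  rw [Ideal.add_mem_iff_right] at h1
  · simp only [zero_le, if_true, tsub_zero, homogeneousComponent_zero] at h1
    rw [constantCoeff_eq] at hs
    have := K.mul_mem_left (C (coeff 0 s)⁻¹) h1
    rwa [← mul_assoc, ← C_mul, inv_mul_cancel₀ hs, C_1, one_mul] at this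
  · refine Ideal.sum_mem K fun i _ => ?_
    split_ifs with hi
    · exact K.mul_mem_left _ (ih _ (by omega))
    · exact zero_mem K

/-- Homogeneous polynomials that form a regular sequence on the local ring of `k[σ] ⧸ J` at the
origin form a regular sequence on `k[σ] ⧸ J`. -/
lemma isWeaklyRegular_quotient_of_localization {J : Ideal (MvPolynomial σ k)}
    (hJ : J.IsHomogeneous (homogeneousSubmodule σ k)) (m : Ideal (MvPolynomial σ k ⧸ J))
    [m.IsPrime] (hm : m.comap (Ideal.Quotient.mk J) = RingHom.ker constantCoeff)
    {Fs : List (MvPolynomial σ k)} (hFs : ∀ F ∈ Fs, ∃ d, F.IsHomogeneous d)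
    (h : IsWeaklyRegular (Localization.AtPrime m)
      ((Fs.map (Ideal.Quotient.mk J)).map (algebraMap _ (Localization.AtPrime m)))) :
    IsWeaklyRegular (MvPolynomial σ k ⧸ J) Fs := by
  rw [isWeaklyRegular_quotient_iff]
  intro i hi f hf
  have hK : (J ⊔ Ideal.ofList (Fs.take i)).IsHomogeneous (homogeneousSubmodule σ k) :=
    hJ.sup (Ideal.homogeneous_span _ _ fun F hF => hFs F (List.mem_of_mem_take hF))
  have hmap : (J ⊔ Ideal.ofList (Fs.take i)).map (Ideal.Quotient.mk J) =
      Ideal.ofList ((Fs.map (Ideal.Quotient.mk J)).take i) := by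
    rw [Ideal.map_sup, Ideal.map_quotient_self, bot_sup_eq, Ideal.map_ofList, List.map_take]
  have hmem : ∀ x, Ideal.Quotient.mk J x ∈ Ideal.ofList ((Fs.map (Ideal.Quotient.mk J)).take i) →
      x ∈ J ⊔ Ideal.ofList (Fs.take i) := fun x hx => by
    rw [← hmap, Ideal.mem_quotient_iff_mem le_sup_left] at hx
    exact hx
  rw [isWeaklyRegular_self_iff] at h
  have h1 := h i (by simpa using hi) (algebraMap _ _ (Ideal.Quotient.mk J f)) (by
    rw [← List.map_take, ← Ideal.map_ofList, ← hmap]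
    simp only [List.getElem_map, ← map_mul]
    exact Ideal.mem_map_of_mem _ (Ideal.mem_map_of_mem _ hf))
  rw [← List.map_take, ← Ideal.map_ofList,
    IsLocalization.algebraMap_mem_map_algebraMap_iff m.primeCompl] at h1
  obtain ⟨s, hs, hsf⟩ := h1
  obtain ⟨s, rfl⟩ := Ideal.Quotient.mk_surjective s
  rw [← map_mul] at hsf
  refine hK.mem_of_mul_mem_of_constantCoeff_ne_zero (s := s) (fun h0 => hs ?_) (hmem _ hsf)
  have : s ∈ m.comap (Ideal.Quotient.mk J) := by
    rw [hm]
    exact h0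
  exact this

end Graded

/-! ### Faces, elementary symmetric polynomials and dimension -/

section Faces

open MvPolynomial RingTheory.Sequence

attribute [local instance] MvPolynomial.gradedAlgebra

/-- Krull dimension does not increase along an integral homomorphism. -/
lemma ringKrullDim_le_of_isIntegral {R S : Type*} [CommRing R] [CommRing S] (f : R →+* S)
    (hf : f.IsIntegral) : ringKrullDim S ≤ ringKrullDim R := by
  algebraize [f]
  exact Order.krullDim_le_of_strictMono (PrimeSpectrum.comap (algebraMap R S)) fun I J hIJ =>
    Ideal.IsIntegral.comap_lt_comap (R := R) (I := I.asIdeal) (J := J.asIdeal) hIJ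

variable {σ : Type*} {k : Type*} [Field k]

lemma MvPolynomial.mem_of_constantCoeff_eq_zero {K : Ideal (MvPolynomial σ k)}
    (hK : ∀ v, X v ∈ K) {f : MvPolynomial σ k} (hf : constantCoeff f = 0) : f ∈ K := by
  have := sub_mem_of_forall_X_sub_mem (k := k) (K := K) (aeval 0) (fun v => by simpa using hK v) f
  rwa [aeval_zero, hf, map_zero, sub_zero] at this

lemma squarefreeIdeal_isHomogeneous (F : Set (Finset σ)) :
    (squarefreeIdeal k F).IsHomogeneous (homogeneousSubmodule σ k) := by
  refine Ideal.homogeneous_span _ _ ?_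
  rintro _ ⟨T, -, rfl⟩
  exact ⟨_, IsHomogeneous.prod T _ _ fun v _ => isHomogeneous_X k v⟩

lemma prod_X_mem_squarefreeIdeal {F : Set (Finset σ)} {S T : Finset σ} (hS : S ∈ F)
    (hST : S ⊆ T) : ∏ v ∈ T, X v ∈ squarefreeIdeal k F :=
  Ideal.mem_of_dvd _ (Finset.prod_dvd_prod_of_subset S T _ hST) (Ideal.subset_span ⟨S, hS, rfl⟩)

/-- The elementary symmetric polynomials of degree larger than the size of every face vanish. -/
lemma esymm_mem_squarefreeIdeal [Fintype σ] {F : Set (Finset σ)} {j : ℕ}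
    (hF : ∀ T : Finset σ, T.card = j → ∃ S ∈ F, S ⊆ T) : esymm σ k j ∈ squarefreeIdeal k F := by
  refine Ideal.sum_mem _ fun T hT => ?_
  obtain ⟨S, hS, hST⟩ := hF T (Finset.mem_powersetCard.mp hT).2
  exact prod_X_mem_squarefreeIdeal hS hST

/-- Vieta's relation: `-X v` is a root of `∏ i, (T + X i)`. -/
lemma sum_esymm_mul_neg_X_pow [Fintype σ] (v : σ) :
    ∑ j ∈ Finset.range (Fintype.card σ + 1),
      esymm σ k j * (-X v) ^ (Fintype.card σ - j) = 0 := by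
  have h := congrArg (Polynomial.eval (-X v)) (prod_C_add_X_eq_sum_esymm k σ)
  rw [Polynomial.eval_prod, Finset.prod_eq_zero (Finset.mem_univ v) (by simp),
    Polynomial.eval_finsetSum] at h
  simpa using h.symm

lemma X_mem_radical_of_esymm_mem [Fintype σ] {K : Ideal (MvPolynomial σ k)}
    (hK : ∀ j, 1 ≤ j → esymm σ k j ∈ K) (v : σ) : X v ∈ K.radical := by
  have h := sum_esymm_mul_neg_X_pow (k := k) v
  rw [Finset.sum_range_succ', esymm_zero, one_mul, tsub_zero, add_eq_zero_iff_neg_eq] at h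
  rw [← neg_mem_iff]
  refine ⟨Fintype.card σ, ?_⟩
  rw [← h]
  exact neg_mem (Ideal.sum_mem _ fun j _ => K.mul_mem_right _ (hK _ (by omega)))

/-- The quotient of `k[σ]` by an ideal containing all elementary symmetric polynomials of degree
larger than `D` is integral over the subring generated by the first `D` of them. -/
lemma isIntegral_esymm [Fintype σ] {J : Ideal (MvPolynomial σ k)} {D : ℕ}
    (hJ : ∀ j, D < j → esymm σ k j ∈ J) :
    ((Ideal.Quotient.mk J).comp
      (aeval (fun i : Fin D => esymm σ k (i + 1)) :
        MvPolynomial (Fin D) k →ₐ[k] MvPolynomial σ k).toRingHom).IsIntegral := by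
  set ψ := (Ideal.Quotient.mk J).comp
      (aeval (fun i : Fin D => esymm σ k (i + 1)) :
        MvPolynomial (Fin D) k →ₐ[k] MvPolynomial σ k).toRingHom with hψ
  have hC : ∀ a, ψ.IsIntegralElem (Ideal.Quotient.mk J (C a)) := fun a => by
    convert ψ.isIntegralElem_map (x := C a) using 1
    simp [hψ]
  have hX : ∀ v, ψ.IsIntegralElem (Ideal.Quotient.mk J (X v)) := fun v => by
    have hc : ∀ j, ∃ c, ψ c = Ideal.Quotient.mk J (esymm σ k (j + 1)) := fun j => by
      by_cases hj : j < D
      · exact ⟨X ⟨j, hj⟩, by simp [hψ]⟩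
      · exact ⟨0, by rw [map_zero, Ideal.Quotient.eq_zero_iff_mem.mpr (hJ _ (by omega))]⟩
    choose c hc using hc
    rw [← neg_neg (X v), map_neg]
    refine RingHom.IsIntegralElem.neg ψ ⟨Polynomial.X ^ Fintype.card σ +
      ∑ j ∈ Finset.range (Fintype.card σ),
        Polynomial.C (c j) * Polynomial.X ^ (Fintype.card σ - (j + 1)), ?_, ?_⟩
    · refine Polynomial.monic_X_pow_add ?_
      refine (Polynomial.degree_sum_le _ _).trans_lt ?_
      rw [Finset.sup_lt_iff (WithBot.bot_lt_coe _)]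
      intro j hj
      refine (Polynomial.degree_C_mul_X_pow_le _ _).trans_lt ?_
      have := Finset.mem_range.mp hj
      exact_mod_cast (by omega : Fintype.card σ - (j + 1) < Fintype.card σ)
    · have h := congrArg (Ideal.Quotient.mk J) (sum_esymm_mul_neg_X_pow (k := k) v)
      rw [Finset.sum_range_succ', esymm_zero, one_mul, tsub_zero, map_add, map_sum,
        map_zero] at h
      simp only [Polynomial.eval₂_add, Polynomial.eval₂_finsetSum, Polynomial.eval₂_mul,
        Polynomial.eval₂_C, Polynomial.eval₂_X_pow, hc]
      rw [add_comm, ← h]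
      simp only [map_mul, map_pow]
  intro y
  obtain ⟨f, rfl⟩ := Ideal.Quotient.mk_surjective y
  induction f using MvPolynomial.induction_on with
  | C a => exact hC a
  | add p q hp hq => rw [map_add]; exact hp.add ψ hq
  | mul_X p v hp => rw [map_mul]; exact hp.mul ψ (hX v)

/-- The prime ideal generated by the variables in `U`, as the kernel of the substitution that
sends them to zero. -/
noncomputable def varsIdeal (k : Type*) [Field k] (U : Set σ) : Ideal (MvPolynomial σ k) :=
  open Classical in
  RingHom.ker (aeval (fun v => if v ∈ U then 0 else X v) : MvPolynomial σ k →ₐ[k] MvPolynomial σ k)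

instance (U : Set σ) : (varsIdeal k U).IsPrime := RingHom.ker_isPrime _

lemma X_mem_varsIdeal {U : Set σ} {v : σ} : X v ∈ varsIdeal k U ↔ v ∈ U := by
  simp [varsIdeal, RingHom.mem_ker]

lemma varsIdeal_mono {U V : Set σ} (h : U ⊆ V) : varsIdeal k U ≤ varsIdeal k V := by
  classical
  intro f hf
  rw [varsIdeal, RingHom.mem_ker] at hf ⊢
  have : (aeval (fun v => if v ∈ V then 0 else X v) : MvPolynomial σ k →ₐ[k] MvPolynomial σ k) =
      (aeval (fun v => if v ∈ V then 0 else X v) : MvPolynomial σ k →ₐ[k] MvPolynomial σ k).comp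
      (aeval (fun v => if v ∈ U then 0 else X v)) := by
    refine algHom_ext fun v => ?_
    by_cases hU : v ∈ U
    · simp [hU, h hU]
    · simp [hU]
  have h2 := DFunLike.congr_fun this f
  rw [AlgHom.comp_apply] at h2
  exact h2.trans ((congrArg _ hf).trans (map_zero _))

lemma varsIdeal_le_ker_constantCoeff (U : Set σ) :
    varsIdeal k U ≤ RingHom.ker (constantCoeff (σ := σ) (R := k)) := by
  classical
  intro f hf
  have : (aeval 0 : MvPolynomial σ k →ₐ[k] k) = (aeval 0 : MvPolynomial σ k →ₐ[k] k).comp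
      (aeval (fun v => if v ∈ U then 0 else X v) : MvPolynomial σ k →ₐ[k] MvPolynomial σ k) := by
    refine algHom_ext fun v => ?_
    by_cases hU : v ∈ U <;> simp [hU]
  have h2 := DFunLike.congr_fun this f
  rw [AlgHom.comp_apply] at h2
  have h3 := h2.trans ((congrArg _ hf).trans (map_zero _))
  rwa [aeval_zero] at h3

lemma squarefreeIdeal_le_varsIdeal {F : Set (Finset σ)} {U : Set σ}
    (h : ∀ S ∈ F, ∃ v ∈ S, v ∈ U) : squarefreeIdeal k F ≤ varsIdeal k U := by
  refine Ideal.span_le.mpr ?_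
  rintro _ ⟨S, hS, rfl⟩
  obtain ⟨v, hv, hvU⟩ := h S hS
  exact Ideal.mem_of_dvd _ (Finset.dvd_prod_of_mem _ hv) (X_mem_varsIdeal.mpr hvU)

/-- The height of the origin in a squarefree monomial quotient is at least the size of each face
`T₀`, by the chain of primes generated by the variables outside decreasing subsets of `T₀`. -/
lemma card_le_height_of_face {F : Set (Finset σ)} {T₀ : Finset σ}
    (hT₀ : ∀ S ∈ F, ¬ S ⊆ T₀) (m : Ideal (MvPolynomial σ k ⧸ squarefreeIdeal k F)) [m.IsPrime]
    (hm : m.comap (Ideal.Quotient.mk _) = RingHom.ker constantCoeff) :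
    (T₀.card : ℕ∞) ≤ m.height := by
  classical
  set J := squarefreeIdeal k F with hJ
  have hle : ∀ T : Finset σ, J ≤ varsIdeal k ((T₀ : Set σ)ᶜ ∪ T) := fun T =>
    squarefreeIdeal_le_varsIdeal fun S hS => by
      obtain ⟨v, hv, hvT⟩ := Finset.not_subset.mp (hT₀ S hS)
      exact ⟨v, hv, Or.inl (by simpa using hvT)⟩
  have hprime : ∀ T : Finset σ,
      ((varsIdeal k ((T₀ : Set σ)ᶜ ∪ T)).map (Ideal.Quotient.mk J)).IsPrime := fun T =>
    Ideal.isPrime_map_quotientMk_of_isPrime (hle T)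
  have hmem : ∀ (T : Finset σ) f, Ideal.Quotient.mk J f ∈
      (varsIdeal k ((T₀ : Set σ)ᶜ ∪ T)).map (Ideal.Quotient.mk J) ↔
      f ∈ varsIdeal k ((T₀ : Set σ)ᶜ ∪ T) := fun T f => Ideal.mem_quotient_iff_mem (hle T)
  have key : ∀ T : Finset σ, T ⊆ T₀ → (T.card : ℕ∞) ≤
      ((varsIdeal k ((T₀ : Set σ)ᶜ ∪ T)).map (Ideal.Quotient.mk J)).height := by
    intro T
    induction T using Finset.induction_on with
    | empty => simp
    | insert a T haT ih =>
      intro hsub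
      have h1 := ih fun v hv => hsub (Finset.mem_insert_of_mem hv)
      have := hprime T
      have := hprime (insert a T)
      rw [Finset.card_insert_of_notMem haT]
      rw [Nat.cast_add, Nat.cast_one]
      refine (add_le_add_left h1 1).trans (Ideal.height_add_one_le_of_lt_of_isPrime ?_)
      refine lt_of_le_of_ne (Ideal.map_mono (varsIdeal_mono ?_)) fun heq => ?_
      · rw [Finset.coe_insert]
        exact Set.union_subset_union_right _ (Set.subset_insert _ _)
      · have h2 := (hmem (insert a T) (X a)).mpr (X_mem_varsIdeal.mpr (by simp))
        rw [Finset.coe_insert] at heq h2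
        rw [← heq, hmem, X_mem_varsIdeal] at h2
        rcases h2 with h2 | h2
        · exact h2 (hsub (Finset.mem_insert_self a T))
        · exact haT h2
  refine (key T₀ subset_rfl).trans (Ideal.height_mono (Ideal.map_le_iff_le_comap.mpr ?_))
  intro f hf
  rw [hm]
  exact varsIdeal_le_ker_constantCoeff _ hf

end Faces

/-! ### The local ring at the origin -/

section CohenMacaulayFaces

open MvPolynomial RingTheory.Sequence

variable {σ : Type*} {k : Type*} [Field k]

lemma MvPolynomial.esymm_isHomogeneous [Fintype σ] (j : ℕ) : (esymm σ k j).IsHomogeneous j := by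
  refine IsHomogeneous.sum _ _ _ fun T hT => ?_
  have := IsHomogeneous.prod T (fun v => (X v : MvPolynomial σ k)) (fun _ => 1)
    fun v _ => isHomogeneous_X k v
  simpa [(Finset.mem_powersetCard.mp hT).2] using this

lemma MvPolynomial.IsHomogeneous.constantCoeff_eq_zero {F : MvPolynomial σ k} {d : ℕ}
    (hF : F.IsHomogeneous d) (hd : d ≠ 0) : constantCoeff F = 0 := by
  rw [constantCoeff_eq]
  exact hF.coeff_eq_zero (by simpa using hd.symm)

/-- The leading form of `p(F)` for a monic polynomial `p` and a homogeneous `F` of positive degree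
is a power of `F`. -/
lemma MvPolynomial.leading_aeval_of_monic {F : MvPolynomial σ k} {d : ℕ}
    (hF : F.IsHomogeneous d) (hd : d ≠ 0) {p : Polynomial k} (hp : p.Monic) :
    (Polynomial.aeval F p).totalDegree ≤ d * p.natDegree ∧
      homogeneousComponent (d * p.natDegree) (Polynomial.aeval F p) = F ^ p.natDegree := by
  have hhom : ∀ i, (p.coeff i • F ^ i).IsHomogeneous (d * i) := fun i =>
    (homogeneousSubmodule σ k (d * i)).smul_mem _ (hF.pow i)
  rw [Polynomial.aeval_eq_sum_range]
  constructor
  · refine (totalDegree_finsetSum _ _).trans (Finset.sup_le fun i hi => ?_)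
    have := Finset.mem_range.mp hi
    exact (hhom i).totalDegree_le.trans (Nat.mul_le_mul_left d (by omega))
  · rw [map_sum, Finset.sum_eq_single p.natDegree]
    · rw [homogeneousComponent_eq_self (hhom _), hp.coeff_natDegree, one_smul]
    · intro i _ hi
      rw [homogeneousComponent_of_mem (hhom i), if_neg]
      exact fun h => hi (Nat.eq_of_mul_eq_mul_left (Nat.pos_of_ne_zero hd) h).symm
    · simp

/-- By the Nullstellensatz, every element of a finitely generated algebra is a root of a monic
polynomial modulo a given maximal ideal. -/
lemma exists_monic_aeval_mem {B : Type*} [CommRing B] [Algebra k B] [Algebra.FiniteType k B]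
    (n : Ideal B) [n.IsMaximal] (b : B) :
    ∃ p : Polynomial k, p.Monic ∧ p.natDegree ≠ 0 ∧ Polynomial.aeval b p ∈ n := by
  let := Ideal.Quotient.field n
  have : Module.Finite k (B ⧸ n) := finite_of_finite_type_of_isJacobsonRing k (B ⧸ n)
  have hint : IsIntegral k (Ideal.Quotient.mkₐ k n b) := IsIntegral.of_finite k _
  refine ⟨minpoly k (Ideal.Quotient.mkₐ k n b), minpoly.monic hint,
    (minpoly.natDegree_pos hint).ne', ?_⟩
  rw [← Ideal.Quotient.eq_zero_iff_mem]
  have := minpoly.aeval k (Ideal.Quotient.mkₐ k n b)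
  rwa [Polynomial.aeval_algHom_apply] at this

/-- Positive powers of the elementary symmetric polynomials are a system of parameters of the local
ring of a squarefree monomial quotient at the origin; if that ring is Cohen–Macaulay, then they are
a regular sequence. -/
lemma esymm_pow_isWeaklyRegular [Fintype σ] {F : Set (Finset σ)} {D : ℕ}
    (hesymm : ∀ j, D < j → esymm σ k j ∈ squarefreeIdeal k F)
    (m : Ideal (MvPolynomial σ k ⧸ squarefreeIdeal k F)) [m.IsPrime]
    (hm : m.comap (Ideal.Quotient.mk _) = RingHom.ker constantCoeff)
    (hreg : HasRegularSequence (Localization.AtPrime m) (Localization.AtPrime m) D)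
    (a : Fin D → ℕ) (ha : ∀ i, a i ≠ 0) :
    IsWeaklyRegular (MvPolynomial σ k ⧸ squarefreeIdeal k F)
      (List.ofFn fun i => esymm σ k (i + 1) ^ a i) := by
  have := IsLocalization.isNoetherianRing m.primeCompl (Localization.AtPrime m) inferInstance
  have hmem : ∀ f, constantCoeff f = 0 → Ideal.Quotient.mk (squarefreeIdeal k F) f ∈ m :=
    fun f hf => by
      have : f ∈ RingHom.ker (constantCoeff (σ := σ) (R := k)) := hf
      rwa [← hm] at this
  refine isWeaklyRegular_quotient_of_localization (squarefreeIdeal_isHomogeneous F) m hm ?_ ?_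
  · intro f hf
    obtain ⟨i, rfl⟩ := List.mem_ofFn.mp hf
    exact ⟨_, (esymm_isHomogeneous _).pow _⟩
  set xs := ((List.ofFn fun i => esymm σ k (i + 1) ^ a i).map (Ideal.Quotient.mk
    (squarefreeIdeal k F))).map (algebraMap _ (Localization.AtPrime m)) with hxs
  have hlen : xs.length = D := by simp [hxs]
  refine HasRegularSequence.isWeaklyRegular_of_le_radical (hlen ▸ hreg) ?_ ?_
  · simp only [hxs, List.forall_mem_map, List.forall_mem_ofFn_iff]
    intro i
    rw [IsLocalization.AtPrime.to_map_mem_maximal_iff _ m]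
    refine hmem _ ?_
    rw [map_pow, (esymm_isHomogeneous _).constantCoeff_eq_zero (by omega), zero_pow (ha i)]
  · refine le_trans ?_ (Ideal.radical_mono le_sup_right)
    -- The preimage in `k[σ]` of the radical contains all the variables.
    set K := (Ideal.ofList xs).radical.comap ((algebraMap _ (Localization.AtPrime m)).comp
      (Ideal.Quotient.mk (squarefreeIdeal k F))) with hK
    have hKrad : K.radical = K := (Ideal.radical_isRadical _).comap _ |>.radical
    have hKesymm : ∀ j, 1 ≤ j → esymm σ k j ∈ K := fun j hj => by
      by_cases hjD : D < j
      · rw [hK, Ideal.mem_comap, RingHom.comp_apply,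
          Ideal.Quotient.eq_zero_iff_mem.mpr (hesymm j hjD), map_zero]
        exact zero_mem _
      · rw [hK, Ideal.mem_comap]
        refine ⟨a ⟨j - 1, by omega⟩, Ideal.subset_span ?_⟩
        rw [← map_pow, RingHom.comp_apply]
        refine List.mem_map_of_mem (List.mem_map_of_mem (List.mem_ofFn.mpr
          ⟨⟨j - 1, by omega⟩, ?_⟩))
        simp only [Nat.sub_add_cancel hj]
    have hX : ∀ v, X v ∈ K := fun v => hKrad ▸ X_mem_radical_of_esymm_mem hKesymm v
    rw [← Localization.AtPrime.map_eq_maximalIdeal, Ideal.map_le_iff_le_comap]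
    intro y hy
    obtain ⟨f, rfl⟩ := Ideal.Quotient.mk_surjective y
    refine mem_of_constantCoeff_eq_zero hX ?_
    have : f ∈ m.comap (Ideal.Quotient.mk _) := hy
    rwa [hm] at this

/-- A squarefree monomial quotient whose local ring at the origin has depth equal to its dimension
is Cohen–Macaulay. -/
theorem isCohenMacaulayRing_of_localization_origin [Finite σ] {F : Set (Finset σ)}
    (hF : ∅ ∉ F) (m : Ideal (MvPolynomial σ k ⧸ squarefreeIdeal k F)) [m.IsPrime]
    (hm : m.comap (Ideal.Quotient.mk _) = RingHom.ker constantCoeff)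
    (h : (localRingDepth (Localization.AtPrime m) : WithBot ℕ∞) =
      ringKrullDim (Localization.AtPrime m)) :
    IsCohenMacaulayRing (MvPolynomial σ k ⧸ squarefreeIdeal k F) := by
  classical
  have := Fintype.ofFinite σ
  -- A face `T₀` of maximal size.
  obtain ⟨T₀, hT₀, hmax⟩ := (Finset.univ.filter fun T : Finset σ =>
    ∀ S ∈ F, ¬ S ⊆ T).exists_max_image Finset.card ⟨∅, by
      simp only [Finset.mem_filter, Finset.mem_univ, true_and, Finset.subset_empty]
      rintro S hS rfl
      exact hF hS⟩
  simp only [Finset.mem_filter, Finset.mem_univ, true_and] at hT₀ hmax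
  set D := T₀.card with hD
  have hesymm : ∀ j, D < j → esymm σ k j ∈ squarefreeIdeal k F := fun j hj =>
    esymm_mem_squarefreeIdeal fun T hT => by
      by_contra! hcon
      have := hmax T hcon
      omega
  have hdim : ringKrullDim (MvPolynomial σ k ⧸ squarefreeIdeal k F) ≤ D := by
    refine (ringKrullDim_le_of_isIntegral _ (isIntegral_esymm hesymm)).trans_eq ?_
    rw [MvPolynomial.ringKrullDim_of_isNoetherianRing, ringKrullDim_eq_zero_of_field, zero_add,
      Nat.card_fin]
  have hdimloc : ∀ (n : Ideal (MvPolynomial σ k ⧸ squarefreeIdeal k F)) [n.IsPrime],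
      ringKrullDim (Localization.AtPrime n) ≤ D := fun n _ => by
    rw [IsLocalization.AtPrime.ringKrullDim_eq_height n (Localization.AtPrime n)]
    exact Ideal.height_le_ringKrullDim_of_isPrime.trans hdim
  have hnoeth : ∀ (n : Ideal (MvPolynomial σ k ⧸ squarefreeIdeal k F)) [n.IsPrime],
      IsNoetherianRing (Localization.AtPrime n) := fun n _ =>
    IsLocalization.isNoetherianRing n.primeCompl (Localization.AtPrime n) inferInstance
  have := hnoeth m
  have hreg : HasRegularSequence (Localization.AtPrime m) (Localization.AtPrime m) D := by
    obtain ⟨r, hr, hdr⟩ := localRingDepth_eq_iff.mp h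
    have h1 := hdimloc m
    have h2 := card_le_height_of_face hT₀ m hm
    rw [hdr] at h1
    rw [IsLocalization.AtPrime.ringKrullDim_eq_height m (Localization.AtPrime m)] at hdr
    have h3 : m.height = r := WithBot.coe_injective hdr
    rw [h3] at h2
    have h4 : D = r := le_antisymm (by exact_mod_cast h2) (by exact_mod_cast h1)
    rwa [h4]
  refine ⟨inferInstance, fun n hn => ?_⟩
  have := hnoeth n
  choose p hp hdeg hpn using fun i : Fin D => exists_monic_aeval_mem (k := k) n
    (Ideal.Quotient.mk (squarefreeIdeal k F) (esymm σ k (i + 1)))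
  have hPs := (IsLeadingIdeal.refl (squarefreeIdeal_isHomogeneous F)).isWeaklyRegular
    (Ps := List.ofFn fun i : Fin D => Polynomial.aeval (esymm σ k (i + 1)) (p i)) ?_
    (esymm_pow_isWeaklyRegular hesymm m hm hreg (fun i => (p i).natDegree) hdeg)
  · have hB := (isWeaklyRegular_map_algebraMap_iff
      (S := MvPolynomial σ k ⧸ squarefreeIdeal k F) _ _).mpr hPs
    have hmem : ∀ x ∈ (List.ofFn fun i : Fin D =>
        Polynomial.aeval (esymm σ k (i + 1)) (p i)).map
          (algebraMap _ (MvPolynomial σ k ⧸ squarefreeIdeal k F)), x ∈ n := by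
      simp only [List.forall_mem_map, List.forall_mem_ofFn_iff]
      intro i
      have := hpn i
      rwa [← Ideal.Quotient.mkₐ_eq_mk k, Polynomial.aeval_algHom_apply] at this
    have hDn : HasRegularSequence (Localization.AtPrime n) (Localization.AtPrime n) D := by
      refine ⟨_, by simp, ?_, hB.isRegular_of_isLocalization_of_mem (Localization.AtPrime n) n hmem⟩
      intro x hx
      obtain ⟨y, hy, rfl⟩ := List.mem_map.mp hx
      exact (IsLocalization.AtPrime.to_map_mem_maximal_iff _ n y).mpr (hmem y hy)
    exact localRingDepth_eq_iff.mpr ⟨D, hDn, le_antisymm (hdimloc n) hDn.le_ringKrullDim⟩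
  · refine List.forall₂_iff_get.mpr ⟨by simp, fun i h1 h2 => ?_⟩
    simp only [List.get_ofFn]
    exact ⟨_, leading_aeval_of_monic (esymm_isHomogeneous _) (by omega) (hp _)⟩

end CohenMacaulayFaces

/-! ### Transfer between `k[x, y] / O` and `k[x] / Ō` -/

section CohenMacaulayTransfer

open MvPolynomial

variable (k : Type*) [Field k] {n : ℕ}

lemma matroidIdeal_eq_squarefreeIdeal (M : OrientedMatroid (Option (Fin n))) :
    matroidIdeal k M = squarefreeIdeal k (signVars '' M.boundedComplex none) := by
  rw [matroidIdeal, squarefreeIdeal, Set.image_image]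
  simp only [signMonomial_eq_prod]

lemma constantCoeff_specialization (f : MvPolynomial (Fin n ⊕ Fin n) k) :
    constantCoeff (specialization k n f) = constantCoeff f := by
  induction f using MvPolynomial.induction_on with
  | C a => simp [specialization]
  | add p q hp hq => simp only [map_add, hp, hq]
  | mul_X p i hp => cases i <;> simp [specialization]

lemma reducedMatroidIdeal_le_ker_constantCoeff (M : OrientedMatroid (Option (Fin n)))
    (hg : ¬ M.IsColoop none) :
    reducedMatroidIdeal k M ≤ RingHom.ker (constantCoeff (σ := Fin n) (R := k)) := by
  refine Ideal.span_le.mpr ?_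
  rintro _ ⟨f, hf, rfl⟩
  exact (constantCoeff_specialization k f).trans (matroidIdeal_le_ker_constantCoeff k M hg hf)

lemma empty_notMem_signVars_boundedComplex (M : OrientedMatroid (Option (Fin n)))
    (hg : ¬ M.IsColoop none) : ∅ ∉ signVars '' M.boundedComplex none := by
  rintro ⟨u, hu, he⟩
  -- The statement is combinatorial; any field of coefficients serves.
  have h := matroidIdeal_le_ker_constantCoeff ℚ M hg
    (Ideal.subset_span (Set.mem_image_of_mem _ hu))
  rw [signMonomial_eq_prod, he, Finset.prod_empty, RingHom.mem_ker, map_one] at h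
  exact one_ne_zero h

/-- The projection of `k[x, y] / O` onto `k[x] / Ō`. -/
noncomputable def reducedProjection (M : OrientedMatroid (Option (Fin n))) :
    MvPolynomial (Fin n ⊕ Fin n) k ⧸ matroidIdeal k M →+*
      MvPolynomial (Fin n) k ⧸ reducedMatroidIdeal k M :=
  Ideal.Quotient.lift (matroidIdeal k M)
    ((Ideal.Quotient.mk (reducedMatroidIdeal k M)).comp
      (specialization k n : MvPolynomial (Fin n ⊕ Fin n) k →+* MvPolynomial (Fin n) k))
    fun _ hf => Ideal.Quotient.eq_zero_iff_mem.mpr (Ideal.mem_map_of_mem _ hf)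

lemma reducedProjection_mk (M : OrientedMatroid (Option (Fin n)))
    (f : MvPolynomial (Fin n ⊕ Fin n) k) :
    reducedProjection k M (Ideal.Quotient.mk _ f) =
      Ideal.Quotient.mk _ (specialization k n f) :=
  rfl

lemma reducedProjection_surjective (M : OrientedMatroid (Option (Fin n))) :
    Function.Surjective (reducedProjection k M) := by
  intro y
  obtain ⟨f, rfl⟩ := Ideal.Quotient.mk_surjective y
  refine ⟨Ideal.Quotient.mk _ (rename Sum.inl f), ?_⟩
  rw [reducedProjection_mk, specialization, aeval_rename, Sum.elim_comp_inl,
    aeval_X_left_apply]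

lemma ker_reducedProjection (M : OrientedMatroid (Option (Fin n))) :
    RingHom.ker (reducedProjection k M) =
      Ideal.ofList ((diffVars k n).map (Ideal.Quotient.mk (matroidIdeal k M))) := by
  ext y
  obtain ⟨f, rfl⟩ := Ideal.Quotient.mk_surjective y
  rw [← Ideal.map_ofList, ← bot_sup_eq (Ideal.map _ _),
    ← Ideal.map_quotient_self (matroidIdeal k M), ← Ideal.map_sup,
    Ideal.mem_quotient_iff_mem le_sup_left, ← ker_mk_comp_specialization, RingHom.mem_ker,
    RingHom.mem_ker, reducedProjection_mk]
  rfl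

end CohenMacaulayTransfer

/-- Restatement of `isCohenMacaulayRing_of_localization_origin` that allows the ideal to be
rewritten inside the dependent types. -/
lemma isCohenMacaulayRing_of_eq_squarefreeIdeal {k : Type*} [Field k] {σ : Type*} [Finite σ]
    {J : Ideal (MvPolynomial σ k)} {F : Set (Finset σ)} (hJ : J = squarefreeIdeal k F)
    (hF : ∅ ∉ F) (m : Ideal (MvPolynomial σ k ⧸ J)) [m.IsPrime]
    (hm : m.comap (Ideal.Quotient.mk J) = RingHom.ker MvPolynomial.constantCoeff)
    (h : (localRingDepth (Localization.AtPrime m) : WithBot ℕ∞) =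
      ringKrullDim (Localization.AtPrime m)) :
    IsCohenMacaulayRing (MvPolynomial σ k ⧸ J) := by
  subst hJ
  exact isCohenMacaulayRing_of_localization_origin hF m hm h

theorem mainTheorem6 (k : Type*) [Field k] (n : ℕ) (M : OrientedMatroid (Option (Fin n)))
    (hg : ¬ M.IsColoop none) :
    RingTheory.Sequence.IsRegular
        (MvPolynomial (Fin n ⊕ Fin n) k ⧸ matroidIdeal k M)
        (List.ofFn fun i : Fin n =>
          (MvPolynomial.X (Sum.inl i) - MvPolynomial.X (Sum.inr i) :
            MvPolynomial (Fin n ⊕ Fin n) k)) ∧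
      (IsCohenMacaulayRing (MvPolynomial (Fin n ⊕ Fin n) k ⧸ matroidIdeal k M) ↔
        IsCohenMacaulayRing (MvPolynomial (Fin n) k ⧸ reducedMatroidIdeal k M)) := by
  refine ⟨diffVars_isRegular k M hg, ?_⟩
  have hsurj := reducedProjection_surjective k M
  have hreg : RingTheory.Sequence.IsWeaklyRegular
      (MvPolynomial (Fin n ⊕ Fin n) k ⧸ matroidIdeal k M)
      ((diffVars k n).map (Ideal.Quotient.mk (matroidIdeal k M))) :=
    (RingTheory.Sequence.isWeaklyRegular_map_algebraMap_iff
      (MvPolynomial (Fin n ⊕ Fin n) k ⧸ matroidIdeal k M) _ _).mpr (diffVars_isWeaklyRegular k M)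
  -- At corresponding primes of the two rings, depth equals dimension for both or for neither.
  have hdepth := localRingDepth_localization_eq_iff _ hsurj hreg (ker_reducedProjection k M)
  constructor
  · refine fun h => ⟨inferInstance, fun m hm => ?_⟩
    have := Ideal.comap_isMaximal_of_surjective _ hsurj (K := m)
    exact (hdepth (m.comap (reducedProjection k M)) m rfl).mp (h.depth_eq_dim _)
  · intro h
    -- The origin, as a maximal ideal `m` of `k[x] / Ō`.
    obtain ⟨m, hmax, hm⟩ : ∃ m : Ideal (MvPolynomial (Fin n) k ⧸ reducedMatroidIdeal k M),
        m.IsMaximal ∧ ∀ f, Ideal.Quotient.mk _ f ∈ m ↔ MvPolynomial.constantCoeff f = 0 :=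
      ⟨RingHom.ker (Ideal.Quotient.lift (reducedMatroidIdeal k M) MvPolynomial.constantCoeff
        (reducedMatroidIdeal_le_ker_constantCoeff k M hg)),
        RingHom.ker_isMaximal_of_surjective _ fun a =>
          ⟨Ideal.Quotient.mk _ (MvPolynomial.C a), MvPolynomial.constantCoeff_C _ a⟩,
        fun f => Iff.rfl⟩
    have hloc := (hdepth (m.comap (reducedProjection k M)) m rfl).mpr (h.depth_eq_dim m)
    refine isCohenMacaulayRing_of_eq_squarefreeIdeal (matroidIdeal_eq_squarefreeIdeal k M)
      (empty_notMem_signVars_boundedComplex M hg) (m.comap (reducedProjection k M)) ?_ hloc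
    ext f
    rw [Ideal.mem_comap, Ideal.mem_comap, reducedProjection_mk, hm,
      constantCoeff_specialization, RingHom.mem_ker]
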